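/- Let $a\ge b\ge 0$ be integers with $a+b=n$, let $1\le k\le n$, and let $Q$ be the uniform probability distribution on the set of $k$-cycles of $S_n$ (permutations of cycle type $(k,1^{n-k})$; for $k=1$ this is the identity). Let $X$ be the set of tabloids of shape $(a,b)$ (row-equivalence classes of bijective fillings of the Young diagram $(a,b)$ by $\{1,\dots,n\}$) with its natural $S_n$-action, let $\mathbb{C}X$ be the permutation module with basis $\{e_x\}_{x\in X}$, let $\|h\|_{\rm TV}=\frac12\sum_{x\in X}|h(x)|$ on $\mathbb{C}X$, and let $\overline{u}_X=\frac1{|X|}\sum_{x\in X}e_x$. For $N\ge 0$ let $Q^{N}$ be the $N$-fold convolution power of $Q$ and $q^{(N)}=\sum_{g\in S_n}Q^{N}(g)e_g\in\mathbb{C}S_n$. Then for every $x_0\in X$ \[ \left\|q^{(N)}\cdot e_{x_0}-\overline{u}_X\right\|_{\rm TV}^2\;\le\;\frac14\sum_{t=1}^{b}\frac{\left(\left[\binom{n-k}{n-t}-\binom{n-k}{n+1-t}\right]+\left[\binom{n-k}{t}-\binom{n-k}{t-1}\right]\right)^{2N}}{\left(\binom nt-\binom n{t-1}\right)^{2N-1}},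 \] where $\binom{m}{j}=0$ for $j>m$ and $0^0=1$. Moreover, for every $1\le t\le b$, the base of the power in the numerator is the value on $k$-cycles of the character of the Specht module $S^{(n-t,t)}$ over $\mathbb{C}$ (the span of the polytabloids of shape $(n-t,t)$), and the base of the power in the denominator is $\dim S^{(n-t,t)}$. -/

import Mathlib

namespace TabloidWalk

/-! ### Random walks on homogeneous spaces -/

section Walk

variable {G X : Type*}

/-- Convolution of functions on a finite group: `(P ∗ Q)(h) = ∑ g, P (h g⁻¹) Q g`. -/
def conv [Group G] [Fintype G] (P Q : G → ℝ) : G → ℝ :=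
  fun h => ∑ g : G, P (h * g⁻¹) * Q g

/-- The `N`-fold convolution power of `Q`; the power `0` is the point mass at the identity. -/
def convPow [Group G] [Fintype G] [DecidableEq G] (Q : G → ℝ) : ℕ → G → ℝ
  | 0 => fun g => if g = 1 then 1 else 0
  | N + 1 => conv Q (convPow Q N)

/-- The element `∑ g, Q g e_g` of the group algebra `ℂ G`. -/
noncomputable def toGroupAlgebra [Fintype G] (Q : G → ℝ) : MonoidAlgebra ℂ G :=
  ∑ g : G, MonoidAlgebra.single g (Q g : ℂ)

/-- The action of an element `q` of `ℂ G` on an element `h` of the permutation module `ℂ X`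
(for `MonoidAlgebra ℂ X`, only the vector space with basis `X` is used, with basis vectors
`e_x = single x 1`). -/
noncomputable def act [Group G] [MulAction G X] (q : MonoidAlgebra ℂ G)
    (h : MonoidAlgebra ℂ X) : MonoidAlgebra ℂ X :=
  (Representation.ofMulAction ℂ G X).asAlgebraHom q h

/-- The element of `ℂ X` corresponding to the uniform distribution on `X`. -/
noncomputable def uniformVec (X : Type*) [Fintype X] : MonoidAlgebra ℂ X :=
  ∑ x : X, MonoidAlgebra.single x ((1 : ℂ) / (Fintype.card X : ℂ))

/-- The total variation norm `‖h‖ = (1/2) ∑ x, |h x|` on `ℂ X`. -/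
noncomputable def tvNorm [Fintype X] (h : MonoidAlgebra ℂ X) : ℝ :=
  (1 / 2) * ∑ x : X, ‖h.coeff x‖

end Walk

/-! ### Cycles -/

/-- `g ∈ S_n` is a `k`-cycle: its cycle type (fixed points included) is `(k, 1, …, 1)` with
`n - k` ones. For `k = 1` this is the identity. -/
def IsKCycle (n k : ℕ) (g : Equiv.Perm (Fin n)) : Prop :=
  g.partition.parts = k ::ₘ Multiset.replicate (n - k) 1

open Classical in
/-- The uniform distribution on the `k`-cycles of `S_n`. -/
noncomputable def kCycleDist (n k : ℕ) (g : Equiv.Perm (Fin n)) : ℝ :=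
  if IsKCycle n k g then 1 / (Nat.card {h : Equiv.Perm (Fin n) // IsKCycle n k h} : ℝ) else 0

/-! ### Tableaux, tabloids and Specht modules -/

/-- The Young diagram with two rows, of lengths `a ≥ b`. -/
def twoRow (a b : ℕ) (h : b ≤ a) : YoungDiagram :=
  YoungDiagram.ofRowLens [a, b] (by
    rw [List.sortedGE_iff_pairwise]; simpa using h)

/-- A tableau of shape `μ`: a filling of the boxes of `μ` with the elements of `Fin n`, each used
exactly once. -/
def Tableau (μ : YoungDiagram) (n : ℕ) : Type := μ.cells ≃ Fin n

namespace Tableau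

variable {μ : YoungDiagram} {n : ℕ}

/-- The row of `T` that contains the entry `i`. -/
def row (T : Tableau μ n) (i : Fin n) : ℕ := (Equiv.symm T i).1.1

/-- The column of `T` that contains the entry `i`. -/
def col (T : Tableau μ n) (i : Fin n) : ℕ := (Equiv.symm T i).1.2

/-- `S_n` acts on tableaux by permuting the entries. -/
instance : MulAction (Equiv.Perm (Fin n)) (Tableau μ n) where
  smul σ T := Equiv.trans T σ
  one_smul _ := rfl
  mul_smul _ _ _ := rfl

theorem row_smul (σ : Equiv.Perm (Fin n)) (T : Tableau μ n) (i : Fin n) :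
    (σ • T).row i = T.row (σ⁻¹ i) := rfl

theorem col_smul (σ : Equiv.Perm (Fin n)) (T : Tableau μ n) (i : Fin n) :
    (σ • T).col i = T.col (σ⁻¹ i) := rfl

/-- Row equivalence: corresponding rows have the same sets of entries. -/
instance rowSetoid (μ : YoungDiagram) (n : ℕ) : Setoid (Tableau μ n) where
  r T T' := ∀ r : ℕ, {i | T.row i = r} = {i | T'.row i = r}
  iseqv := ⟨fun _ _ => rfl, fun h r => (h r).symm, fun h h' r => (h r).trans (h' r)⟩

theorem smul_equiv (σ : Equiv.Perm (Fin n)) {T T' : Tableau μ n} (h : T ≈ T') :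
    σ • T ≈ σ • T' := by
  intro r
  ext i
  exact Set.ext_iff.mp (h r) (σ⁻¹ i)

end Tableau

/-- A tabloid of shape `μ`: a row-equivalence class of tableaux. -/
def Tabloid (μ : YoungDiagram) (n : ℕ) : Type := Quotient (Tableau.rowSetoid μ n)

namespace Tabloid

variable {μ : YoungDiagram} {n : ℕ}

/-- The tabloid of a tableau. -/
def mk (T : Tableau μ n) : Tabloid μ n := Quotient.mk _ T

/-- `S_n` acts on tabloids by permuting the entries. -/
instance : MulAction (Equiv.Perm (Fin n)) (Tabloid μ n) where
  smul σ := Quotient.map (σ • ·) fun _ _ h => Tableau.smul_equiv σ h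
  one_smul x := by
    induction x using Quotient.inductionOn with
    | h T => rfl
  mul_smul σ τ x := by
    induction x using Quotient.inductionOn with
    | h T => rfl

theorem smul_mk (σ : Equiv.Perm (Fin n)) (T : Tableau μ n) : σ • mk T = mk (σ • T) := rfl

instance : Finite (Tableau μ n) := inferInstanceAs (Finite (μ.cells ≃ Fin n))

instance : Finite (Tabloid μ n) := inferInstanceAs (Finite (Quotient (Tableau.rowSetoid μ n)))

noncomputable instance : Fintype (Tabloid μ n) := Fintype.ofFinite _

end Tabloid

section Specht

variable {μ : YoungDiagram} {n : ℕ}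

/-- `π` is in the column stabilizer of `T`: it maps each column of `T` to itself. -/
def IsColPerm (T : Tableau μ n) (π : Equiv.Perm (Fin n)) : Prop :=
  ∀ i, T.col (π i) = T.col i

open Classical in
/-- The polytabloid `∑ π, sgn π • π {T}`, over the column stabilizer of `T`. -/
noncomputable def polytabloid (T : Tableau μ n) : MonoidAlgebra ℂ (Tabloid μ n) :=
  ∑ π : Equiv.Perm (Fin n) with IsColPerm T π,
    MonoidAlgebra.single (π • Tabloid.mk T) ((Equiv.Perm.sign π : ℤ) : ℂ)

theorem ofMulAction_polytabloid (σ : Equiv.Perm (Fin n)) (T : Tableau μ n) :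
    Representation.ofMulAction ℂ (Equiv.Perm (Fin n)) (Tabloid μ n) σ (polytabloid T) =
      polytabloid (σ • T) := by
  unfold polytabloid
  rw [map_sum]
  refine Finset.sum_equiv (MulAut.conj σ).toEquiv ?_ ?_
  · intro π
    simp only [Finset.mem_filter, Finset.mem_univ, true_and]
    constructor
    · intro h i
      simpa [Tableau.col_smul] using h (σ⁻¹ i)
    · intro h i
      simpa [Tableau.col_smul] using h (σ i)
  · intro π _
    rw [Representation.ofMulAction_single]
    have h1 : (MulAut.conj σ).toEquiv π = σ * π * σ⁻¹ := rfl
    have h2 : (σ * π * σ⁻¹) • Tabloid.mk (σ • T) = σ • π • Tabloid.mk T := by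
      rw [← Tabloid.smul_mk, ← mul_smul, ← mul_smul]
      simp
    rw [h1, h2]
    congr 3
    rw [map_mul, map_mul, map_inv, mul_comm, inv_mul_cancel_left]

/-- The Specht module `S^μ` inside the permutation module on tabloids of shape `μ`: the span of the
polytabloids. -/
noncomputable def specht (μ : YoungDiagram) (n : ℕ) :
    Subrepresentation
      (Representation.ofMulAction ℂ (Equiv.Perm (Fin n)) (Tabloid μ n)) where
  toSubmodule := Submodule.span ℂ (Set.range polytabloid)
  apply_mem_toSubmodule σ v hv := by
    induction hv using Submodule.span_induction with
    | mem x hx =>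
      obtain ⟨T, rfl⟩ := hx
      rw [ofMulAction_polytabloid]
      exact Submodule.subset_span ⟨_, rfl⟩
    | zero => simp
    | add x y _ _ hx hy => rw [map_add]; exact Submodule.add_mem _ hx hy
    | smul c x _ hx => rw [map_smul]; exact Submodule.smul_mem _ c hx

end Specht

end TabloidWalk

open scoped Pointwise

/-! A two-row tabloid is determined by its bottom row, so `ℂX` is the space of functions on
`b`-subsets. The walk has a symmetric transition matrix `T` (`k`-cycles are closed under inversion)
that commutes with the transitive action of `S_n`. By Cauchy–Schwarz the squared distance is at most
`1/4 (|X| (T ^ (2N)) x₀ x₀ - 1) = 1/4 (tr T ^ (2N) - 1)`, and this trace is the sum over `g` of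
`Q^{2N}(g)` times the number of tabloids fixed by `g` (`tvNorm_sq_le_trace`).

The fixed-point count telescopes over `t ≤ b` into differences of the numbers of invariant `t`- and
`(t-1)`-subsets. Each difference is the character of `S^{(n-t,t)}`, because that module is the
kernel of the surjective lowering map from `t`-subsets to `(t-1)`-subsets (`lower_surjective`,
`specht_eq_ker_lower`, `character_specht`). The class function `Q` acts on it by a scalar
(`exists_scalar_on_specht`), which equals the character at a `k`-cycle divided by the dimension `d`.
The term for `t` is therefore `(χ/d)^{2N} d`. Finally, a `k`-cycle preserves a set exactly when the
set contains the cycle or misses it, which gives the binomials.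

Neither irreducibility nor a basis of standard polytabloids is used: column antisymmetry replaces
both. -/

namespace TabloidWalk

/-! ### Raising and lowering operators on the Boolean lattice. -/

section SetFunctions

variable {n : ℕ}

/-- The lowering operator on functions on the subsets of `Fin n`: the value at `B` is the sum over
the sets obtained from `B` by adding one element. -/
def down : (Finset (Fin n) → ℂ) →ₗ[ℂ] (Finset (Fin n) → ℂ) where
  toFun f B := ∑ x ∈ Bᶜ, f (insert x B)
  map_add' f g := by ext B; simp [Finset.sum_add_distrib]
  map_smul' c f := by ext B; simp [Finset.mul_sum]

/-- The raising operator on functions on the subsets of `Fin n`: the value at `A` is the sum over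
the sets obtained from `A` by removing one element. -/
def up : (Finset (Fin n) → ℂ) →ₗ[ℂ] (Finset (Fin n) → ℂ) where
  toFun f A := ∑ x ∈ A, f (A.erase x)
  map_add' f g := by ext B; simp [Finset.sum_add_distrib]
  map_smul' c f := by ext B; simp [Finset.mul_sum]

theorem down_apply (f : Finset (Fin n) → ℂ) (B : Finset (Fin n)) :
    down f B = ∑ x ∈ Bᶜ, f (insert x B) := rfl

theorem up_apply (f : Finset (Fin n) → ℂ) (A : Finset (Fin n)) :
    up f A = ∑ x ∈ A, f (A.erase x) := rfl

theorem down_comp_smul (σ : Equiv.Perm (Fin n)) (f : Finset (Fin n) → ℂ) (B : Finset (Fin n)) :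
    down (fun A => f (σ • A)) B = down f (σ • B) := by
  rw [down_apply, down_apply]
  refine Finset.sum_equiv σ ?_ ?_
  · intro x
    have : σ x ∈ σ • B ↔ x ∈ B := Finset.smul_mem_smul_finset_iff (a := σ) (b := x)
    simp [this]
  · intro x _
    rw [Finset.smul_finset_insert, Equiv.Perm.smul_def]

/-- The `sl₂` commutation relation. Exchanging an element of `B` for one outside contributes equally
to both compositions; only the returns to `B` differ, `n - |B|` against `|B|` of them. -/
theorem down_up (f : Finset (Fin n) → ℂ) (B : Finset (Fin n)) :
    down (up f) B = up (down f) B + ((n : ℂ) - 2 * B.card) * f B := by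
  have h1 : down (up f) B = ∑ x ∈ Bᶜ, (f B + ∑ y ∈ B, f ((insert x B).erase y)) := by
    rw [down_apply]
    refine Finset.sum_congr rfl fun x hx => ?_
    have hx : x ∉ B := by simpa using hx
    rw [up_apply, Finset.sum_insert hx, Finset.erase_insert hx]
  have h2 : up (down f) B = ∑ y ∈ B, (f B + ∑ x ∈ Bᶜ, f ((insert x B).erase y)) := by
    rw [up_apply]
    refine Finset.sum_congr rfl fun y hy => ?_
    have : (B.erase y)ᶜ = insert y Bᶜ := by simp
    rw [down_apply, this, Finset.sum_insert (by simpa using hy), Finset.insert_erase hy]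
    refine congrArg _ ?_
    refine Finset.sum_congr rfl fun x hx => ?_
    rw [Finset.erase_insert_of_ne]
    rintro rfl
    simp [hy] at hx
  rw [h1, h2, Finset.sum_add_distrib, Finset.sum_add_distrib, Finset.sum_comm]
  have hc : ((Bᶜ.card : ℕ) : ℂ) = n - B.card := by
    rw [Finset.card_compl, Nat.cast_sub (Finset.card_le_univ B), Fintype.card_fin]
  simp only [Finset.sum_const, nsmul_eq_mul, hc]
  ring

theorem sum_up_mul (f g : Finset (Fin n) → ℂ) :
    ∑ A, up f A * g A = ∑ B, f B * down g B := by
  simp only [up_apply, down_apply, Finset.sum_mul, Finset.mul_sum]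
  rw [Finset.sum_sigma', Finset.sum_sigma']
  refine Finset.sum_bij' (fun p _ => ⟨p.1.erase p.2, p.2⟩) (fun p _ => ⟨insert p.2 p.1, p.2⟩)
    ?_ ?_ ?_ ?_ ?_
  · simp
  · simp
  · rintro ⟨A, x⟩ h
    have : x ∈ A := by simpa using h
    simp [Finset.insert_erase this]
  · rintro ⟨A, x⟩ h
    have : x ∉ A := by simpa using h
    simp [Finset.erase_insert this]
  · rintro ⟨A, x⟩ h
    have : x ∈ A := by simpa using h
    simp [Finset.insert_erase this]

/-- Positivity: since `up` and `down` are adjoint, pairing `down (up f)` with the conjugate of `f`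
gives `‖down f‖² + (n - 2j)‖f‖²`, and the second coefficient is positive below the middle layer. -/
theorem eq_zero_of_down_up_eq_zero {j : ℕ} (hj : 2 * j < n) {f : Finset (Fin n) → ℂ}
    (hf : ∀ A, A.card ≠ j → f A = 0) (h : down (up f) = 0) : f = 0 := by
  have key : ∑ B, (Complex.normSq (down f B) + ((n : ℝ) - 2 * B.card) * Complex.normSq (f B))
      = 0 := by
    have h0 : ∑ B, down (up f) B * star (f B) = 0 := by simp [h]
    simp only [down_up, add_mul, Finset.sum_add_distrib] at h0
    rw [sum_up_mul] at h0
    have hs : ∀ B, down (fun B => star (f B)) B = star (down f B) := by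
      intro B
      simp [down_apply]
    simp only [hs] at h0
    have : ((∑ B, (Complex.normSq (down f B) + ((n : ℝ) - 2 * B.card) * Complex.normSq (f B)) : ℝ)
        : ℂ) = 0 := by
      rw [← h0]
      push_cast
      rw [Finset.sum_add_distrib]
      congr 1
      · refine Finset.sum_congr rfl fun B _ => ?_
        rw [← Complex.mul_conj]; rfl
      · refine Finset.sum_congr rfl fun B _ => ?_
        rw [← Complex.mul_conj, ← mul_assoc]; rfl
    exact_mod_cast this
  have hpos : ∀ B ∈ Finset.univ,
      0 ≤ Complex.normSq (down f B) + ((n : ℝ) - 2 * B.card) * Complex.normSq (f B) := by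
    intro B _
    by_cases hB : B.card = j
    · have : (0 : ℝ) ≤ n - 2 * B.card := by
        rw [hB, sub_nonneg]; exact_mod_cast hj.le
      have := mul_nonneg this (Complex.normSq_nonneg (f B))
      linarith [Complex.normSq_nonneg (down f B)]
    · simp [hf B hB, Complex.normSq_nonneg]
  have hz := (Finset.sum_eq_zero_iff_of_nonneg hpos).mp key
  ext B
  by_cases hB : B.card = j
  · have h1 := hz B (Finset.mem_univ B)
    have h2 : (0 : ℝ) < n - 2 * B.card := by
      rw [hB, sub_pos]; exact_mod_cast hj
    have h3 := Complex.normSq_nonneg (down f B)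
    have h4 := Complex.normSq_nonneg (f B)
    have h5 : Complex.normSq (f B) = 0 := by
      by_contra hne
      have := mul_pos h2 (lt_of_le_of_ne h4 (Ne.symm hne))
      linarith
    simpa using h5
  · simp [hf B hB]

theorem down_eq_zero_of_card {t : ℕ} {f : Finset (Fin n) → ℂ}
    (hf : ∀ A, A.card ≠ t + 1 → f A = 0) (B : Finset (Fin n)) (hB : B.card ≠ t) :
    down f B = 0 := by
  rw [down_apply]
  refine Finset.sum_eq_zero fun x hx => hf _ ?_
  rw [Finset.card_insert_of_notMem (by simpa using hx)]
  omega

theorem up_eq_zero_of_card {t : ℕ} {f : Finset (Fin n) → ℂ}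
    (hf : ∀ A, A.card ≠ t → f A = 0) (A : Finset (Fin n)) (hA : A.card ≠ t + 1) :
    up f A = 0 := by
  rw [up_apply]
  refine Finset.sum_eq_zero fun x hx => hf _ ?_
  have := Finset.card_erase_add_one hx
  omega

end SetFunctions

/-! ### The bottom row of a tabloid -/

section Bottom

variable {μ : YoungDiagram} {n : ℕ}

/-- The set of entries in the second row of a tableau. -/
def Tableau.bot (T : Tableau μ n) : Finset (Fin n) := {i | T.row i = 1}

theorem Tableau.mem_bot {T : Tableau μ n} {i : Fin n} : i ∈ T.bot ↔ T.row i = 1 := by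
  simp [Tableau.bot]

/-- The set of entries in the second row of a tabloid. -/
def Tabloid.bot (x : Tabloid μ n) : Finset (Fin n) :=
  Quotient.lift Tableau.bot (fun T T' h => by
    ext i
    rw [Tableau.mem_bot, Tableau.mem_bot]
    exact Set.ext_iff.mp (h 1) i) x

theorem Tabloid.bot_mk (T : Tableau μ n) : (Tabloid.mk T).bot = T.bot := rfl

theorem Tableau.bot_smul (σ : Equiv.Perm (Fin n)) (T : Tableau μ n) :
    (σ • T).bot = σ • T.bot := by
  ext i
  rw [Tableau.mem_bot, Tableau.row_smul, ← Finset.inv_smul_mem_iff, Tableau.mem_bot]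
  rfl

theorem Tabloid.exists_mk (x : Tabloid μ n) : ∃ T, Tabloid.mk T = x := Quotient.exists_rep x

theorem Tabloid.bot_smul (σ : Equiv.Perm (Fin n)) (x : Tabloid μ n) :
    (σ • x).bot = σ • x.bot := by
  obtain ⟨T, rfl⟩ := x.exists_mk
  rw [Tabloid.smul_mk, Tabloid.bot_mk, Tabloid.bot_mk, Tableau.bot_smul]

theorem Tableau.exists_smul_eq (T T' : Tableau μ n) : ∃ σ : Equiv.Perm (Fin n), σ • T = T' :=
  ⟨(Equiv.symm T).trans T',
    Equiv.ext fun c => congrArg (Equiv.toFun T') (Equiv.symm_apply_apply T c)⟩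

theorem Tabloid.exists_smul_eq (x y : Tabloid μ n) : ∃ σ : Equiv.Perm (Fin n), σ • x = y := by
  obtain ⟨T, rfl⟩ := x.exists_mk
  obtain ⟨T', rfl⟩ := y.exists_mk
  obtain ⟨σ, rfl⟩ := T.exists_smul_eq T'
  exact ⟨σ, rfl⟩

theorem mem_twoRow {a b : ℕ} {h : b ≤ a} {c : ℕ × ℕ} :
    c ∈ (twoRow a b h).cells ↔ c.1 = 0 ∧ c.2 < a ∨ c.1 = 1 ∧ c.2 < b := by
  rw [YoungDiagram.mem_cells, twoRow, YoungDiagram.mem_ofRowLens]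
  obtain ⟨i, j⟩ := c
  rcases i with _ | _ | i <;> simp

theorem card_twoRow {a b : ℕ} (h : b ≤ a) : (twoRow a b h).cells.card = a + b := by
  have : (twoRow a b h).cells
      = ({0} ×ˢ Finset.range a) ∪ ({1} ×ˢ Finset.range b) := by
    ext c
    rw [mem_twoRow]
    simp only [Finset.mem_union, Finset.mem_product, Finset.mem_singleton, Finset.mem_range]
  rw [this, Finset.card_union_of_disjoint]
  · simp
  · rw [Finset.disjoint_left]
    rintro ⟨i, j⟩ h1 h2
    simp only [Finset.mem_product, Finset.mem_singleton] at h1 h2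
    omega

variable {a b : ℕ} {hab : b ≤ a}

theorem Tableau.row_col (T : Tableau (twoRow a b hab) n) (i : Fin n) :
    T.row i = 0 ∧ T.col i < a ∨ T.row i = 1 ∧ T.col i < b :=
  mem_twoRow.mp (Equiv.symm T i).2

theorem Tableau.ext_row_col (T : Tableau μ n) {i j : Fin n} (hr : T.row i = T.row j)
    (hc : T.col i = T.col j) : i = j :=
  (Equiv.symm T).injective (Subtype.ext (Prod.ext hr hc))

theorem Tableau.exists_entry (T : Tableau (twoRow a b hab) n) {r c : ℕ}
    (h : r = 0 ∧ c < a ∨ r = 1 ∧ c < b) : ∃ i, T.row i = r ∧ T.col i = c :=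
  ⟨Equiv.toFun T ⟨(r, c), mem_twoRow.mpr h⟩, by
    simp only [Tableau.row, Tableau.col]
    erw [Equiv.symm_apply_apply]
    exact ⟨rfl, rfl⟩⟩

theorem Tableau.card_bot (T : Tableau (twoRow a b hab) n) : T.bot.card = b := by
  refine (Finset.card_bij (t := Finset.range b) (fun i _ => T.col i) ?_ ?_ ?_).trans
    (Finset.card_range b)
  · intro i hi
    have := T.row_col i
    rw [Tableau.mem_bot] at hi
    simp; omega
  · intro i hi j hj h
    rw [Tableau.mem_bot] at hi hj
    exact T.ext_row_col (hi.trans hj.symm) h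
  · intro c hc
    obtain ⟨i, h1, h2⟩ := T.exists_entry (r := 1) (c := c) (by simpa using hc)
    exact ⟨i, T.mem_bot.mpr h1, h2⟩

theorem Tabloid.card_bot (x : Tabloid (twoRow a b hab) n) : x.bot.card = b := by
  obtain ⟨T, rfl⟩ := x.exists_mk
  exact T.card_bot

theorem Tabloid.bot_injective :
    Function.Injective (Tabloid.bot : Tabloid (twoRow a b hab) n → Finset (Fin n)) := by
  intro x y h
  obtain ⟨T, rfl⟩ := x.exists_mk
  obtain ⟨T', rfl⟩ := y.exists_mk
  refine Quotient.sound fun r => ?_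
  ext i
  have h1 := Finset.ext_iff.mp h i
  rw [Tabloid.bot_mk, Tabloid.bot_mk, Tableau.mem_bot, Tableau.mem_bot] at h1
  have h2 := T.row_col i
  have h3 := T'.row_col i
  simp only [Set.mem_ofPred_eq]
  omega

theorem nonempty_tableau (hn : a + b = n) : Nonempty (Tableau (twoRow a b hab) n) := by
  refine ⟨(Fintype.equivOfCardEq ?_ : (twoRow a b hab).cells ≃ Fin n)⟩
  rw [Fintype.card_coe, card_twoRow, hn, Fintype.card_fin]

theorem Tabloid.exists_bot_eq (hn : a + b = n) (A : Finset (Fin n)) (hA : A.card = b) :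
    ∃ x : Tabloid (twoRow a b hab) n, x.bot = A := by
  obtain ⟨T⟩ := nonempty_tableau (hab := hab) hn
  obtain ⟨σ, hσ⟩ := (Set.powersetCard.isPretransitive (n := b) (α := Fin n)).exists_smul_eq
    ⟨T.bot, T.card_bot⟩ ⟨A, hA⟩
  refine ⟨σ • Tabloid.mk T, ?_⟩
  rw [Tabloid.bot_smul]
  exact congrArg Subtype.val hσ

end Bottom

/-! ### Tabloid modules as functions on subsets. -/

section Transfer

variable {μ : YoungDiagram} {n : ℕ}

/-- The function on subsets of `Fin n` attached to an element of the permutation module on tabloids: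
its value at `A` is the sum of the coefficients of the tabloids with second row `A`. -/
noncomputable def evalBot :
    MonoidAlgebra ℂ (Tabloid μ n) →ₗ[ℂ] (Finset (Fin n) → ℂ) where
  toFun h A := ∑ x : Tabloid μ n, if x.bot = A then h.coeff x else 0
  map_add' f g := by
    ext A
    simp only [MonoidAlgebra.coeff_add, Finsupp.add_apply, Pi.add_apply, ← Finset.sum_add_distrib]
    refine Finset.sum_congr rfl fun x _ => ?_
    split_ifs <;> simp
  map_smul' c f := by
    ext A
    simp [Finset.mul_sum]

theorem evalBot_apply (h : MonoidAlgebra ℂ (Tabloid μ n)) (A : Finset (Fin n)) :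
    evalBot h A = ∑ x : Tabloid μ n, if x.bot = A then h.coeff x else 0 := rfl

/-- The element of the permutation module on tabloids whose coefficient at a tabloid is the value of
a given function at its second row. -/
noncomputable def ofBot :
    (Finset (Fin n) → ℂ) →ₗ[ℂ] MonoidAlgebra ℂ (Tabloid μ n) where
  toFun f := ∑ x : Tabloid μ n, MonoidAlgebra.single x (f x.bot)
  map_add' f g := by simp [Finset.sum_add_distrib, MonoidAlgebra.single_add]
  map_smul' c f := by simp [Finset.smul_sum]

theorem coeff_sum_single {X : Type*} [Fintype X] (f : X → ℂ) (x : X) :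
    (∑ y : X, MonoidAlgebra.single y (f y)).coeff x = f x := by
  classical
  rw [MonoidAlgebra.coeff_sum, Finsupp.finsetSum_apply]
  simp [Finsupp.single_apply]

theorem coeff_ofBot (f : Finset (Fin n) → ℂ) (x : Tabloid μ n) :
    (ofBot f).coeff x = f x.bot :=
  coeff_sum_single (fun x : Tabloid μ n => f x.bot) x

theorem evalBot_ofMulAction (σ : Equiv.Perm (Fin n)) (h : MonoidAlgebra ℂ (Tabloid μ n))
    (A : Finset (Fin n)) :
    evalBot (Representation.ofMulAction ℂ (Equiv.Perm (Fin n)) (Tabloid μ n) σ h) A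
      = evalBot h (σ⁻¹ • A) := by
  rw [evalBot_apply, evalBot_apply]
  refine Fintype.sum_equiv (MulAction.toPerm σ⁻¹) _ _ fun x => ?_
  rw [Representation.coeff_ofMulAction, MulAction.toPerm_apply, Tabloid.bot_smul]
  simp

theorem ofBot_smul (σ : Equiv.Perm (Fin n)) (f : Finset (Fin n) → ℂ) :
    (ofBot (fun A => f (σ⁻¹ • A)) : MonoidAlgebra ℂ (Tabloid μ n))
      = Representation.ofMulAction ℂ (Equiv.Perm (Fin n)) (Tabloid μ n) σ (ofBot f) := by
  ext x
  rw [Representation.coeff_ofMulAction, coeff_ofBot, coeff_ofBot, Tabloid.bot_smul]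

variable {a b : ℕ} {hab : b ≤ a}

theorem evalBot_bot (h : MonoidAlgebra ℂ (Tabloid (twoRow a b hab) n))
    (x : Tabloid (twoRow a b hab) n) : evalBot h x.bot = h.coeff x := by
  classical
  rw [evalBot_apply]
  simp [Tabloid.bot_injective.eq_iff]

theorem evalBot_of_card_ne (h : MonoidAlgebra ℂ (Tabloid (twoRow a b hab) n))
    (A : Finset (Fin n)) (hA : A.card ≠ b) : evalBot h A = 0 := by
  rw [evalBot_apply]
  refine Finset.sum_eq_zero fun x _ => if_neg ?_
  rintro rfl
  exact hA x.card_bot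

theorem ofBot_evalBot (h : MonoidAlgebra ℂ (Tabloid (twoRow a b hab) n)) :
    ofBot (evalBot h) = h := by
  ext x
  rw [coeff_ofBot, evalBot_bot]

theorem evalBot_ofBot (hn : a + b = n) {f : Finset (Fin n) → ℂ}
    (hf : ∀ A, A.card ≠ b → f A = 0) :
    evalBot (ofBot f : MonoidAlgebra ℂ (Tabloid (twoRow a b hab) n)) = f := by
  ext A
  by_cases hA : A.card = b
  · obtain ⟨x, rfl⟩ := Tabloid.exists_bot_eq (hab := hab) hn A hA
    rw [evalBot_bot, coeff_ofBot]
  · rw [evalBot_of_card_ne _ _ hA, hf A hA]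

theorem evalBot_injective : Function.Injective
    (evalBot : MonoidAlgebra ℂ (Tabloid (twoRow a b hab) n) →ₗ[ℂ] _) :=
  Function.LeftInverse.injective ofBot_evalBot

end Transfer

/-! ### The lowering map between permutation modules -/

section Lower

variable {n a b a' b' : ℕ} {hab : b ≤ a} {hab' : b' ≤ a'}

/-- The lowering operator, as a map between permutation modules on tabloids. -/
noncomputable def lower (hab : b ≤ a) (hab' : b' ≤ a') (n : ℕ) :
    MonoidAlgebra ℂ (Tabloid (twoRow a b hab) n) →ₗ[ℂ]
      MonoidAlgebra ℂ (Tabloid (twoRow a' b' hab') n) :=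
  ofBot ∘ₗ down ∘ₗ evalBot

theorem lower_apply (h : MonoidAlgebra ℂ (Tabloid (twoRow a b hab) n)) :
    lower hab hab' n h = ofBot (down (evalBot h)) := rfl

theorem lower_ofMulAction (σ : Equiv.Perm (Fin n))
    (h : MonoidAlgebra ℂ (Tabloid (twoRow a b hab) n)) :
    lower hab hab' n (Representation.ofMulAction ℂ (Equiv.Perm (Fin n)) _ σ h)
      = Representation.ofMulAction ℂ (Equiv.Perm (Fin n)) _ σ (lower hab hab' n h) := by
  rw [lower_apply, lower_apply, ← ofBot_smul]
  congr 1
  ext A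
  rw [← down_comp_smul]
  exact congrArg (fun f => down f A) (funext (evalBot_ofMulAction σ h))

theorem evalBot_lower (hn' : a' + b' = n) (hb : b = b' + 1)
    (h : MonoidAlgebra ℂ (Tabloid (twoRow a b hab) n)) :
    evalBot (lower hab hab' n h) = down (evalBot h) := by
  subst hb
  exact evalBot_ofBot hn' (down_eq_zero_of_card (evalBot_of_card_ne h))

/-- Raising followed by lowering is an injective endomorphism of a finite-dimensional space, as `2 *
b' < n`; hence it is onto, and so is lowering. -/
theorem lower_surjective (hn : a + b = n) (hn' : a' + b' = n) (hb : b = b' + 1) :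
    Function.Surjective (lower hab hab' n) := by
  subst hb
  set E : MonoidAlgebra ℂ (Tabloid (twoRow a' b' hab') n) →ₗ[ℂ]
      MonoidAlgebra ℂ (Tabloid (twoRow a' b' hab') n) :=
    lower hab hab' n ∘ₗ ofBot ∘ₗ up ∘ₗ evalBot with hE
  have hEa : ∀ h, evalBot (E h) = down (up (evalBot h)) := by
    intro h
    rw [hE, LinearMap.comp_apply, evalBot_lower hn' rfl]
    congr 1
    exact evalBot_ofBot hn (up_eq_zero_of_card (evalBot_of_card_ne h))
  have hinj : Function.Injective E := by
    rw [← LinearMap.ker_eq_bot, LinearMap.ker_eq_bot']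
    intro h hh
    apply evalBot_injective
    rw [map_zero]
    refine eq_zero_of_down_up_eq_zero (j := b') (by omega) (evalBot_of_card_ne h) ?_
    rw [← hEa, hh, map_zero]
  have : FiniteDimensional ℂ (MonoidAlgebra ℂ (Tabloid (twoRow a' b' hab') n)) := inferInstance
  have hsurj := LinearMap.injective_iff_surjective.mp hinj
  intro y
  obtain ⟨h, rfl⟩ := hsurj y
  exact ⟨_, rfl⟩

end Lower

/-! ### Antisymmetric functions -/

section Antisymmetric

variable {n : ℕ}

theorem eq_zero_of_swap_antisymm {g : Finset (Fin n) → ℂ} {i j : Fin n} {A : Finset (Fin n)}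
    (h : g (Equiv.swap i j • A) = - g A) (hA : i ∈ A ↔ j ∈ A) : g A = 0 := by
  have : Equiv.swap i j • A = A := by
    ext x
    rw [← Finset.inv_smul_mem_iff, Equiv.swap_inv, Equiv.Perm.smul_def]
    rcases eq_or_ne x i with rfl | hi
    · rw [Equiv.swap_apply_left, hA]
    rcases eq_or_ne x j with rfl | hj
    · rw [Equiv.swap_apply_right, hA]
    rw [Equiv.swap_apply_of_ne_of_ne hi hj]
  rw [this] at h
  exact self_eq_neg.mp h

theorem mem_swap_smul {i j x : Fin n} {A : Finset (Fin n)} :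
    x ∈ Equiv.swap i j • A ↔ Equiv.swap i j x ∈ A := by
  rw [← Finset.inv_smul_mem_iff, Equiv.swap_inv, Equiv.Perm.smul_def]

/-- The function `g` on sets changes its sign under the exchange of two entries of one of the
columns `0, …, s - 1` of `T`. -/
def IsColAntisymm {μ : YoungDiagram} (T : Tableau μ n) (s : ℕ) (g : Finset (Fin n) → ℂ) : Prop :=
  ∀ i j, i ≠ j → T.col i = T.col j → T.col i < s → ∀ A, g (Equiv.swap i j • A) = - g A

variable {a b : ℕ} {hab : b ≤ a}

theorem Tableau.exists_partner (T : Tableau (twoRow a b hab) n) {i : Fin n} (hi : T.col i < b) :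
    ∃ j, i ≠ j ∧ T.col i = T.col j ∧ T.row i + T.row j = 1 := by
  rcases T.row_col i with ⟨h1, -⟩ | ⟨h1, -⟩
  · obtain ⟨j, h2, h3⟩ := T.exists_entry (r := 1) (c := T.col i) (by omega)
    refine ⟨j, ?_, h3.symm, by omega⟩
    rintro rfl; omega
  · obtain ⟨j, h2, h3⟩ := T.exists_entry (r := 0) (c := T.col i) (by omega)
    refine ⟨j, ?_, h3.symm, by omega⟩
    rintro rfl; omega

theorem Tableau.col_lt_of_col_eq (T : Tableau (twoRow a b hab) n) {i j : Fin n} (hij : i ≠ j)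
    (hc : T.col i = T.col j) : T.col i < b := by
  by_contra h
  have h1 := T.row_col i
  have h2 := T.row_col j
  exact hij (T.ext_row_col (by omega) hc)

/-- Antisymmetry in all columns leaves one degree of freedom. If `A` misses a bottom entry `i` with
column partner `j`, then either `j ∈ A`, and the swap brings `A` closer to `T.bot` at the cost of a
sign, or the swap fixes `A` and `g A = 0`. -/
theorem IsColAntisymm.eq_zero {T : Tableau (twoRow a b hab) n} {g : Finset (Fin n) → ℂ}
    (hg : IsColAntisymm T b g) (hc : ∀ A, A.card ≠ b → g A = 0) (h0 : g T.bot = 0) : g = 0 := by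
  suffices H : ∀ m : ℕ, ∀ A : Finset (Fin n), (T.bot \ A).card = m → g A = 0 from
    funext fun A => H _ A rfl
  intro m
  induction m using Nat.strong_induction_on with
  | _ m ih =>
    intro A hm
    by_cases hA : A.card = b
    · rcases (T.bot \ A).eq_empty_or_nonempty with he | ⟨i, hi⟩
      · rw [Finset.sdiff_eq_empty_iff_subset] at he
        rw [← Finset.eq_of_subset_of_card_le he (by rw [hA, T.card_bot])]
        exact h0
      · rw [Finset.mem_sdiff, Tableau.mem_bot] at hi
        have hib : T.col i < b := by have := T.row_col i; omega
        obtain ⟨j, hij, hcol, hrow⟩ := T.exists_partner hib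
        have hs := hg i j hij hcol hib A
        by_cases hj : j ∈ A
        · have hlt : (T.bot \ (Equiv.swap i j • A)).card < m := by
            rw [← hm]
            refine Finset.card_lt_card ⟨?_, ?_⟩
            · intro x hx
              rw [Finset.mem_sdiff, mem_swap_smul, Tableau.mem_bot] at hx
              rw [Finset.mem_sdiff, Tableau.mem_bot]
              refine ⟨hx.1, fun hxA => hx.2 ?_⟩
              rw [Equiv.swap_apply_of_ne_of_ne]
              · exact hxA
              · rintro rfl; exact hi.2 hxA
              · rintro rfl; omega
            · intro hsub
              have := hsub (Finset.mem_sdiff.mpr ⟨T.mem_bot.mpr hi.1, hi.2⟩)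
              rw [Finset.mem_sdiff, mem_swap_smul, Equiv.swap_apply_left] at this
              exact this.2 hj
          have := ih _ hlt _ rfl
          rw [this] at hs
          simpa using hs.symm
        · exact eq_zero_of_swap_antisymm hs (by simp [hi.2, hj])
    · exact hc A hA

/-- Column permutations are products of transpositions inside columns: multiplying by `swap i (π i)`
shrinks the support. -/
theorem IsColAntisymm.smul_of_isColPerm {T : Tableau (twoRow a b hab) n}
    {g : Finset (Fin n) → ℂ} (hg : IsColAntisymm T b g) :
    ∀ π : Equiv.Perm (Fin n), IsColPerm T π → ∀ A,
      g (π • A) = ((Equiv.Perm.sign π : ℤ) : ℂ) * g A := by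
  suffices H : ∀ m : ℕ, ∀ π : Equiv.Perm (Fin n), π.support.card = m → IsColPerm T π → ∀ A,
      g (π • A) = ((Equiv.Perm.sign π : ℤ) : ℂ) * g A from fun π => H _ π rfl
  intro m
  induction m using Nat.strong_induction_on with
  | _ m ih =>
    intro π hm hπ A
    by_cases h1 : π = 1
    · simp [h1]
    · obtain ⟨i, hi⟩ : ∃ i, π i ≠ i := by
        by_contra! h
        exact h1 (Equiv.ext h)
      have hlt := Equiv.Perm.card_support_swap_mul hi
      have hcol : IsColPerm T (Equiv.swap i (π i) * π) := by
        intro x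
        rw [← hπ x, Equiv.Perm.mul_apply]
        rcases eq_or_ne (π x) i with h | h
        · rw [h, Equiv.swap_apply_left, hπ]
        rcases eq_or_ne (π x) (π i) with h' | h'
        · rw [h', Equiv.swap_apply_right, hπ]
        · rw [Equiv.swap_apply_of_ne_of_ne h h']
      have h2 := ih _ (hm ▸ hlt) _ rfl hcol A
      have h3 := hg i (π i) hi.symm (hπ i).symm (T.col_lt_of_col_eq hi.symm (hπ i).symm)
        (π • A)
      rw [mul_smul, h3, map_mul, Equiv.Perm.sign_swap hi.symm] at h2
      push_cast at h2
      linear_combination -h2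

/-- The pairing of a function on sets with the polytabloid of `T`. -/
noncomputable def pairPolytabloid {μ : YoungDiagram} (g : Finset (Fin n) → ℂ) (T : Tableau μ n) :
    ℂ := by
  classical
  exact ∑ π : Equiv.Perm (Fin n) with IsColPerm T π, ((Equiv.Perm.sign π : ℤ) : ℂ) * g (π • T.bot)

theorem isColPerm_conj {μ : YoungDiagram} {T : Tableau μ n} {σ π : Equiv.Perm (Fin n)} :
    IsColPerm (σ • T) (σ * π * σ⁻¹) ↔ IsColPerm T π := by
  constructor
  · intro h i
    simpa [Tableau.col_smul] using h (σ i)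
  · intro h i
    simpa [Tableau.col_smul] using h (σ⁻¹ i)

theorem pairPolytabloid_smul {μ : YoungDiagram} (σ : Equiv.Perm (Fin n))
    (g : Finset (Fin n) → ℂ) (T : Tableau μ n) :
    pairPolytabloid (fun A => g (σ • A)) T = pairPolytabloid g (σ • T) := by
  classical
  rw [pairPolytabloid, pairPolytabloid]
  refine Finset.sum_equiv (MulAut.conj σ).toEquiv ?_ ?_
  · intro π
    simp only [Finset.mem_filter, Finset.mem_univ, true_and]
    exact isColPerm_conj.symm
  · intro π _
    have h1 : (MulAut.conj σ).toEquiv π = σ * π * σ⁻¹ := rfl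
    rw [h1, Tableau.bot_smul, ← mul_smul, ← mul_smul, inv_mul_cancel_right]
    congr 3
    rw [map_mul, map_mul, map_inv, mul_comm, inv_mul_cancel_left]

/-- The signs cancel, so the pairing is `g T.bot` times the order of the column stabilizer. -/
theorem IsColAntisymm.eq_zero_of_pairPolytabloid {T : Tableau (twoRow a b hab) n}
    {g : Finset (Fin n) → ℂ} (hg : IsColAntisymm T b g) (hc : ∀ A, A.card ≠ b → g A = 0)
    (h0 : pairPolytabloid g T = 0) : g = 0 := by
  classical
  refine hg.eq_zero hc ?_
  have h1 : pairPolytabloid g T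
      = ∑ π : Equiv.Perm (Fin n) with IsColPerm T π, g T.bot := by
    rw [pairPolytabloid]
    refine Finset.sum_congr rfl fun π hπ => ?_
    rw [hg.smul_of_isColPerm π (by simpa using hπ), ← mul_assoc, ← Int.cast_mul]
    rw [Int.units_coe_mul_self]
    simp
  rw [h1, Finset.sum_const, nsmul_eq_mul, mul_eq_zero] at h0
  refine h0.resolve_left ?_
  refine Nat.cast_ne_zero.mpr ?_
  refine Finset.card_ne_zero_of_mem (a := 1) ?_
  exact Finset.mem_filter.mpr ⟨Finset.mem_univ _, fun _ => rfl⟩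

end Antisymmetric

/-! ### The Specht module is the kernel of the lowering map -/

section SpechtKernel

variable {n a b : ℕ} {hab : b ≤ a}

/-- Serves to make `{i, j}` the column `s` of a new tableau without disturbing the columns already
treated. -/
theorem Tableau.exists_smul_cols (T : Tableau (twoRow a b hab) n) {s : ℕ} (hs : s < b)
    {i j : Fin n} (hij : i ≠ j) (hi : s ≤ T.col i) (hj : s ≤ T.col j) :
    ∃ σ : Equiv.Perm (Fin n), (∀ x, T.col x < s → σ x = x) ∧
      (∀ x, T.col x = s → σ x = i ∨ σ x = j) := by
  obtain ⟨i₀, hi₀, hi₀'⟩ := T.exists_entry (r := 0) (c := s) (by omega)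
  obtain ⟨j₀, hj₀, hj₀'⟩ := T.exists_entry (r := 1) (c := s) (by omega)
  have h0 : j₀ ≠ i₀ := by rintro rfl; omega
  -- The first swap may displace `j₀`; `j₁` is where it lands, and the second swap must start there.
  set j₁ := Equiv.swap i₀ i j₀ with hj₁
  have hj₁i : i ≠ j₁ := by
    intro h
    have : Equiv.swap i₀ i i₀ = Equiv.swap i₀ i j₀ := by rw [Equiv.swap_apply_left, ← hj₁, h]
    exact h0 ((Equiv.swap i₀ i).injective this).symm
  have hcol₁ : s ≤ T.col j₁ := by
    rw [hj₁, Equiv.swap_apply_def]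
    split_ifs <;> omega
  refine ⟨Equiv.swap j₁ j * Equiv.swap i₀ i, ?_, ?_⟩
  · intro x hx
    have h1 : ∀ y, s ≤ T.col y → x ≠ y := by rintro y hy rfl; omega
    rw [Equiv.Perm.mul_apply, Equiv.swap_apply_of_ne_of_ne (h1 _ hi₀'.ge) (h1 _ hi),
      Equiv.swap_apply_of_ne_of_ne (h1 _ hcol₁) (h1 _ hj)]
  · intro x hx
    rcases T.row_col x with ⟨h, -⟩ | ⟨h, -⟩
    · left
      rw [T.ext_row_col (h.trans hi₀.symm) (hx.trans hi₀'.symm), Equiv.Perm.mul_apply,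
        Equiv.swap_apply_left, Equiv.swap_apply_of_ne_of_ne hj₁i hij]
    · right
      rw [T.ext_row_col (h.trans hj₀.symm) (hx.trans hj₀'.symm), Equiv.Perm.mul_apply, ← hj₁,
        Equiv.swap_apply_left]

/-- Swaps in the earlier columns commute with `swap i j`, so antisymmetry there survives; the new
column is `{i, j}`, for which the difference is antisymmetric by construction. -/
theorem IsColAntisymm.sub_swap {T : Tableau (twoRow a b hab) n} {s : ℕ}
    {g : Finset (Fin n) → ℂ} (hg : IsColAntisymm T s g) {i j : Fin n}
    (hi : s ≤ T.col i) (hj : s ≤ T.col j) {σ : Equiv.Perm (Fin n)}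
    (h1 : ∀ x, T.col x < s → σ x = x) (h2 : ∀ x, T.col x = s → σ x = i ∨ σ x = j) :
    IsColAntisymm (σ • T) (s + 1) (fun A => g A - g (Equiv.swap i j • A)) := by
  intro x y hxy hcol hlt A
  rw [Tableau.col_smul] at hcol hlt
  rw [Tableau.col_smul] at hcol
  obtain ⟨u, rfl⟩ := σ.surjective x
  obtain ⟨v, rfl⟩ := σ.surjective y
  have hinv : ∀ x, σ⁻¹ (σ x) = x := σ.symm_apply_apply
  rw [hinv] at hcol hlt
  rw [hinv] at hcol
  have huv : u ≠ v := fun h => hxy (congrArg σ h)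
  rcases Nat.lt_or_ge (T.col u) s with hu | hu
  · rw [h1 u hu, h1 v (hcol ▸ hu)]
    have hd : ∀ z w, T.col z < s → s ≤ T.col w → z ≠ w := by rintro z w hz hw rfl; omega
    have hcomm : Equiv.swap i j * Equiv.swap u v = Equiv.swap u v * Equiv.swap i j := by
      have hv : T.col v < s := hcol ▸ hu
      rw [Equiv.swap_mul_eq_mul_swap]
      simp only [Equiv.swap_inv]
      rw [Equiv.swap_apply_of_ne_of_ne (hd u i hu hi).symm (hd v i hv hi).symm,
        Equiv.swap_apply_of_ne_of_ne (hd u j hu hj).symm (hd v j hv hj).symm]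
    simp only
    rw [← mul_smul, hcomm, mul_smul, hg u v huv hcol hu, hg u v huv hcol hu]
    ring
  · have hus : T.col u = s := by omega
    have hvs : T.col v = s := by omega
    have hsw : Equiv.swap (σ u) (σ v) = Equiv.swap i j := by
      rcases h2 u hus with h | h <;> rcases h2 v hvs with h' | h'
      · exact absurd (h.trans h'.symm) hxy
      · rw [h, h']
      · rw [h, h', Equiv.swap_comm]
      · exact absurd (h.trans h'.symm) hxy
    simp only
    rw [hsw, ← mul_smul, Equiv.swap_mul_self, one_smul]
    ring

/-- If `g A ≠ 0`, then `A` meets each of the first `s` columns exactly once, so it has an element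
`x` in a later column. In `down g (A.erase x)`, adding an entry of a later column gives `g A` by
invariance, while adding one of an early column fills that column and gives `0`. The sum is a
positive multiple of `g A`. -/
theorem IsColAntisymm.eq_zero_of_swap_invariant {T : Tableau (twoRow a b hab) n} {s : ℕ}
    (hs : s < b) {g : Finset (Fin n) → ℂ} (hg : IsColAntisymm T s g)
    (hc : ∀ A, A.card ≠ b → g A = 0) (hd : down g = 0)
    (hinv : ∀ i j, i ≠ j → s ≤ T.col i → s ≤ T.col j → ∀ A, g (Equiv.swap i j • A) = g A) :
    g = 0 := by
  ext A
  by_contra hA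
  have hcard : A.card = b := by
    by_contra h
    exact hA (hc A h)
  have htrans : ∀ i j, i ≠ j → T.col i = T.col j → T.col i < s → (i ∈ A ↔ j ∉ A) := by
    intro i j hij hcol hlt
    have := mt (eq_zero_of_swap_antisymm (hg i j hij hcol hlt A)) hA
    tauto
  obtain ⟨x, hxA, hx⟩ : ∃ x ∈ A, s ≤ T.col x := by
    by_contra! h
    have := Finset.card_le_card_of_injOn (s := A) (t := Finset.range s) T.col
      (fun x hx => Finset.mem_coe.mpr (Finset.mem_range.mpr (h x hx))) (by
        intro y hy z hz hyz
        by_contra hne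
        exact ((htrans y z hne hyz (h y hy)).mp hy) hz)
    rw [Finset.card_range] at this
    omega
  have h0 := congrFun hd (A.erase x)
  have hterm : ∀ y ∈ (A.erase x)ᶜ, g (insert y (A.erase x)) = if s ≤ T.col y then g A else 0 := by
    intro y hy
    rw [Finset.mem_compl, Finset.mem_erase, not_and] at hy
    rcases eq_or_ne y x with rfl | hyx
    · rw [Finset.insert_erase hxA, if_pos hx]
    have hyA := hy hyx
    split_ifs with hys
    · rw [← hinv x y hyx.symm hx hys A]
      congr 1
      ext z
      rw [mem_swap_smul, Finset.mem_insert, Finset.mem_erase]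
      rcases eq_or_ne z x with rfl | hzx
      · rw [Equiv.swap_apply_left]; simp [hyA, hyx.symm]
      rcases eq_or_ne z y with rfl | hzy
      · rw [Equiv.swap_apply_right]; simp [hxA]
      · rw [Equiv.swap_apply_of_ne_of_ne hzx hzy]; simp [hzx, hzy]
    · rw [not_le] at hys
      obtain ⟨z, hyz, hcol, -⟩ := T.exists_partner (hys.trans hs)
      refine eq_zero_of_swap_antisymm (hg y z hyz hcol hys _) ?_
      have hzA : z ∈ A := by
        by_contra h
        exact hyA ((htrans y z hyz hcol hys).mpr h)
      have hzx : z ≠ x := by rintro rfl; omega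
      simp [hzA, hzx]
  rw [down_apply, Finset.sum_congr rfl hterm, ← Finset.sum_filter, Finset.sum_const,
    nsmul_eq_mul, Pi.zero_apply, mul_eq_zero] at h0
  refine hA (h0.resolve_left (Nat.cast_ne_zero.mpr ?_))
  exact Finset.card_ne_zero_of_mem (a := x) (by simp [hx])

/-- Induction on the number `d` of columns not yet antisymmetrized. Each difference `g - g ∘ swap i
j` satisfies the hypotheses with one more column, so it vanishes; then `g` is invariant under swaps
in the remaining columns. -/
theorem IsColAntisymm.eq_zero_of_forall_pair (d : ℕ) :
    ∀ s, s + d = b → ∀ (T : Tableau (twoRow a b hab) n) (g : Finset (Fin n) → ℂ),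
      IsColAntisymm T s g → (∀ A, A.card ≠ b → g A = 0) → down g = 0 →
      (∀ T : Tableau (twoRow a b hab) n, pairPolytabloid g T = 0) → g = 0 := by
  induction d with
  | zero =>
    intro s hs T g hg hc _ hp
    rw [add_zero] at hs
    subst hs
    exact hg.eq_zero_of_pairPolytabloid hc (hp T)
  | succ d ih =>
    intro s hs T g hg hc hd hp
    refine hg.eq_zero_of_swap_invariant (by omega) hc hd ?_
    intro i j hij hi hj A
    obtain ⟨σ, h1, h2⟩ := T.exists_smul_cols (by omega) hij hi hj
    have := ih (s + 1) (by omega) (σ • T) _ (hg.sub_swap hi hj h1 h2) ?_ ?_ ?_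
    · exact (sub_eq_zero.mp (congrFun this A)).symm
    · intro A hA
      rw [hc A hA, hc _ (by rwa [Finset.card_smul_finset]), sub_zero]
    · change down (g - fun A => g (Equiv.swap i j • A)) = 0
      rw [map_sub, hd, zero_sub, neg_eq_zero]
      ext B
      rw [down_comp_smul, hd]
      rfl
    · intro T'
      have h3 : pairPolytabloid (fun A => g A - g (Equiv.swap i j • A)) T'
          = pairPolytabloid g T' - pairPolytabloid (fun A => g (Equiv.swap i j • A)) T' := by
        simp only [pairPolytabloid, mul_sub, Finset.sum_sub_distrib]
      rw [h3, pairPolytabloid_smul, hp, hp, sub_zero]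

theorem eq_zero_of_forall_pairPolytabloid (hn : a + b = n) {g : Finset (Fin n) → ℂ}
    (hc : ∀ A, A.card ≠ b → g A = 0) (hd : down g = 0)
    (hp : ∀ T : Tableau (twoRow a b hab) n, pairPolytabloid g T = 0) : g = 0 := by
  obtain ⟨T⟩ := nonempty_tableau (hab := hab) hn
  -- With `s = 0` the antisymmetry condition is vacuous.
  refine IsColAntisymm.eq_zero_of_forall_pair b 0 (zero_add b) T g ?_ hc hd hp
  intro i j _ _ h
  omega

theorem ofMulAction_polytabloid_of_isColPerm {μ : YoungDiagram} {T : Tableau μ n}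
    {τ : Equiv.Perm (Fin n)} (hτ : IsColPerm T τ) :
    Representation.ofMulAction ℂ (Equiv.Perm (Fin n)) (Tabloid μ n) τ (polytabloid T)
      = ((Equiv.Perm.sign τ : ℤ) : ℂ) • polytabloid T := by
  classical
  unfold polytabloid
  rw [map_sum, Finset.smul_sum]
  refine Finset.sum_equiv (Equiv.mulLeft τ) ?_ ?_
  · intro π
    simp only [Finset.mem_filter, Finset.mem_univ, true_and, Equiv.coe_mulLeft]
    constructor
    · intro h i
      rw [Equiv.Perm.mul_apply, hτ, h]
    · intro h i
      rw [← hτ, ← Equiv.Perm.mul_apply, h]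
  · intro π _
    rw [Representation.ofMulAction_single, MonoidAlgebra.smul_single, Equiv.coe_mulLeft, mul_smul,
      map_mul, smul_eq_mul, Units.val_mul, Int.cast_mul, ← mul_assoc, ← Int.cast_mul,
      Int.units_coe_mul_self, Int.cast_one, one_mul]

theorem isColPerm_swap {μ : YoungDiagram} {T : Tableau μ n} {i j : Fin n}
    (h : T.col i = T.col j) : IsColPerm T (Equiv.swap i j) := by
  intro x
  rw [Equiv.swap_apply_def]
  split_ifs with h1 h2
  · rw [h1, h]
  · rw [h2, h]
  · rfl

theorem IsColAntisymm.evalBot_of_forall {μ : YoungDiagram} {T : Tableau μ n} {s : ℕ}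
    {h : MonoidAlgebra ℂ (Tabloid μ n)}
    (hh : ∀ τ, IsColPerm T τ →
      Representation.ofMulAction ℂ (Equiv.Perm (Fin n)) (Tabloid μ n) τ h
        = ((Equiv.Perm.sign τ : ℤ) : ℂ) • h) :
    IsColAntisymm T s (evalBot h) := by
  intro i j hij hcol _ A
  have := congrFun (congrArg evalBot (hh _ (isColPerm_swap hcol))) A
  rw [evalBot_ofMulAction, Equiv.swap_inv, map_smul, Equiv.Perm.sign_swap hij] at this
  simpa using this

/-- A set of `b - 1` entries misses one of the `b` two-box columns entirely. Swapping that column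
fixes the set but changes the sign of the value. -/
theorem down_evalBot_polytabloid (hb : 1 ≤ b) (T : Tableau (twoRow a b hab) n) :
    down (evalBot (polytabloid T)) = 0 := by
  have hg : IsColAntisymm T b (evalBot (polytabloid T)) :=
    IsColAntisymm.evalBot_of_forall fun τ hτ => ofMulAction_polytabloid_of_isColPerm hτ
  obtain ⟨b, rfl⟩ : ∃ c, b = c + 1 := ⟨b - 1, by omega⟩
  ext B
  by_cases hB : B.card = b
  · obtain ⟨c, hc, hcB⟩ : ∃ c ∈ Finset.range (b + 1), c ∉ B.image T.col := by
      by_contra! h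
      have h1 := Finset.card_le_card h
      have h2 := Finset.card_image_le (s := B) (f := T.col)
      rw [Finset.card_range] at h1
      omega
    rw [Finset.mem_range] at hc
    obtain ⟨i, hi, hi'⟩ := T.exists_entry (r := 0) (c := c) (by omega)
    obtain ⟨j, hj, hj'⟩ := T.exists_entry (r := 1) (c := c) (by omega)
    refine eq_zero_of_swap_antisymm (i := i) (j := j) ?_ ?_
    · rw [← down_comp_smul]
      have : (fun A => evalBot (polytabloid T) (Equiv.swap i j • A))
          = - evalBot (polytabloid T) := by
        ext A
        exact hg i j (by rintro rfl; omega) (hi'.trans hj'.symm) (by omega) A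
      rw [this, map_neg]
      rfl
    · have h1 : i ∉ B := fun h => hcB (Finset.mem_image.mpr ⟨i, h, hi'⟩)
      have h2 : j ∉ B := fun h => hcB (Finset.mem_image.mpr ⟨j, h, hj'⟩)
      simp [h1, h2]
  · exact down_eq_zero_of_card (evalBot_of_card_ne _) B hB

/-- The bilinear pairing of two elements of the permutation module on tabloids. -/
noncomputable def tabloidPairing (μ : YoungDiagram) (n : ℕ) :
    MonoidAlgebra ℂ (Tabloid μ n) →ₗ[ℂ] MonoidAlgebra ℂ (Tabloid μ n) →ₗ[ℂ] ℂ :=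
  LinearMap.mk₂ ℂ (fun g h => ∑ x, h.coeff x * g.coeff x)
    (by intros; simp [mul_add, Finset.sum_add_distrib])
    (by intros; simp [Finset.mul_sum, mul_left_comm])
    (by intros; simp [add_mul, Finset.sum_add_distrib])
    (by intros; simp [Finset.mul_sum, mul_assoc])

theorem tabloidPairing_polytabloid (g : MonoidAlgebra ℂ (Tabloid (twoRow a b hab) n))
    (T : Tableau (twoRow a b hab) n) :
    tabloidPairing _ n g (polytabloid T) = pairPolytabloid (evalBot g) T := by
  classical
  unfold polytabloid pairPolytabloid
  rw [map_sum]
  refine Finset.sum_congr rfl fun π _ => ?_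
  have h1 : π • T.bot = (π • Tabloid.mk T).bot := by rw [Tabloid.bot_smul, Tabloid.bot_mk]
  rw [h1, evalBot_bot]
  simp [tabloidPairing, Finsupp.single_apply]

/-- The reverse inclusion is a dimension count: no nonzero element of the kernel is orthogonal to
all polytabloids, so the kernel embeds in the dual of the Specht module. -/
theorem specht_eq_ker_lower {a' b' : ℕ} {hab' : b' ≤ a'} (hn : a + b = n) (hn' : a' + b' = n)
    (hb : b = b' + 1) :
    (specht (twoRow a b hab) n).toSubmodule = LinearMap.ker (lower hab hab' n) := by
  have hle : (specht (twoRow a b hab) n).toSubmodule ≤ LinearMap.ker (lower hab hab' n) := by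
    refine Submodule.span_le.mpr ?_
    rintro _ ⟨T, rfl⟩
    rw [SetLike.mem_coe, LinearMap.mem_ker, lower_apply, down_evalBot_polytabloid (by omega),
      map_zero]
  refine Submodule.eq_of_le_of_finrank_le hle ?_
  rw [← Subspace.dual_finrank_eq (V := (specht (twoRow a b hab) n).toSubmodule)]
  set φ : LinearMap.ker (lower hab hab' n) →ₗ[ℂ]
      Module.Dual ℂ (specht (twoRow a b hab) n).toSubmodule :=
    (Module.Dual.transpose (specht (twoRow a b hab) n).toSubmodule.subtype) ∘ₗ
      tabloidPairing _ n ∘ₗ (LinearMap.ker (lower hab hab' n)).subtype with hφ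
  refine LinearMap.finrank_le_finrank_of_injective (f := φ) ?_
  rw [← LinearMap.ker_eq_bot, LinearMap.ker_eq_bot']
  rintro ⟨g, hg⟩ h
  rw [LinearMap.mem_ker] at hg
  refine Subtype.ext (evalBot_injective ?_)
  rw [Submodule.coe_zero, map_zero]
  refine eq_zero_of_forall_pairPolytabloid hn (hab := hab) (evalBot_of_card_ne g) ?_ ?_
  · rw [← evalBot_lower hn' hb, hg, map_zero]
  · intro T
    rw [← tabloidPairing_polytabloid]
    exact LinearMap.congr_fun h ⟨polytabloid T, Submodule.subset_span ⟨T, rfl⟩⟩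

end SpechtKernel

/-! ### Traces -/

section Trace

/-- Additivity of the trace on `0 → ker D → V → W → 0`: a section `s` of `D` splits `A` into two
composites, to which cyclicity of the trace applies. -/
theorem trace_restrict_ker {K V W : Type*} [Field K] [AddCommGroup V] [Module K V]
    [FiniteDimensional K V] [AddCommGroup W] [Module K W] [FiniteDimensional K W]
    {D : V →ₗ[K] W} (hD : Function.Surjective D) {A : V →ₗ[K] V} {B : W →ₗ[K] W}
    (h : ∀ v, D (A v) = B (D v)) {S : Submodule K V} (hS : S = LinearMap.ker D)
    (hA : ∀ v ∈ S, A v ∈ S) :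
    LinearMap.trace K S (A.restrict hA) = LinearMap.trace K V A - LinearMap.trace K W B := by
  subst hS
  obtain ⟨s, hs⟩ := D.exists_rightInverse_of_surjective (LinearMap.range_eq_top.mpr hD)
  have hs' : ∀ w, D (s w) = w := fun w => LinearMap.congr_fun hs w
  set p : V →ₗ[K] LinearMap.ker D :=
    (LinearMap.id - s ∘ₗ D).codRestrict _ (fun v => by simp [hs']) with hp
  have h1 : A.restrict hA = (p ∘ₗ A) ∘ₗ (LinearMap.ker D).subtype := by
    ext v
    have hv : D (A v) = 0 := hA v v.2
    simp [hp, hv]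
  have h2 : B = (D ∘ₗ A) ∘ₗ s := by
    ext w
    simp [h, hs']
  have h3 : A = (LinearMap.ker D).subtype ∘ₗ p ∘ₗ A + s ∘ₗ D ∘ₗ A := by
    ext v
    simp [hp]
  rw [h1, h2, LinearMap.trace_comp_comm' (LinearMap.ker D).subtype,
    LinearMap.trace_comp_comm' s, eq_sub_iff_add_eq, ← map_add, ← h3]

theorem character_ofMulAction {G X : Type*} [Group G] [MulAction G X] [Fintype X]
    [DecidableEq X] (g : G) :
    (Representation.ofMulAction ℂ G X).character g = ((Finset.univ.filter
      fun x : X => g • x = x).card : ℂ) := by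
  rw [Representation.character,
    LinearMap.trace_eq_matrix_trace ℂ (Module.Basis.ofRepr (MonoidAlgebra.coeffLinearEquiv ℂ)),
    Matrix.trace, Finset.card_filter, Nat.cast_sum]
  refine Finset.sum_congr rfl fun x _ => ?_
  rw [Matrix.diag_apply, LinearMap.toMatrix_apply]
  have h1 : (Module.Basis.ofRepr (MonoidAlgebra.coeffLinearEquiv ℂ) :
      Module.Basis X ℂ (MonoidAlgebra ℂ X)) x = MonoidAlgebra.single x 1 := rfl
  have h2 : ∀ v : MonoidAlgebra ℂ X, (Module.Basis.ofRepr (MonoidAlgebra.coeffLinearEquiv ℂ) :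
      Module.Basis X ℂ (MonoidAlgebra ℂ X)).repr v = v.coeff := fun _ => rfl
  rw [h1, h2, Representation.ofMulAction_single, MonoidAlgebra.coeff_single, Finsupp.single_apply]
  split_ifs <;> simp

/-- The number of `t`-element subsets that are mapped to themselves by a permutation. -/
def fixedSets {n : ℕ} (t : ℕ) (g : Equiv.Perm (Fin n)) : ℕ :=
  (Finset.univ.filter fun A : Finset (Fin n) => A.card = t ∧ g • A = A).card

variable {n a b : ℕ} {hab : b ≤ a}

theorem card_fixed_tabloid [DecidableEq (Tabloid (twoRow a b hab) n)] (hn : a + b = n) (g : Equiv.Perm (Fin n)) :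
    (Finset.univ.filter fun x : Tabloid (twoRow a b hab) n => g • x = x).card
      = fixedSets b g := by
  refine Finset.card_bij (fun x _ => x.bot) ?_ ?_ ?_
  · intro x hx
    simp only [Finset.mem_filter, Finset.mem_univ, true_and] at hx ⊢
    exact ⟨x.card_bot, by rw [← Tabloid.bot_smul, hx]⟩
  · intro x _ y _ h
    exact Tabloid.bot_injective h
  · intro A hA
    simp only [Finset.mem_filter, Finset.mem_univ, true_and] at hA
    obtain ⟨x, rfl⟩ := Tabloid.exists_bot_eq (hab := hab) hn A hA.1
    refine ⟨x, ?_, rfl⟩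
    simp only [Finset.mem_filter, Finset.mem_univ, true_and]
    apply Tabloid.bot_injective
    rw [Tabloid.bot_smul, hA.2]

theorem character_tabloid (hn : a + b = n) (g : Equiv.Perm (Fin n)) :
    (Representation.ofMulAction ℂ (Equiv.Perm (Fin n)) (Tabloid (twoRow a b hab) n)).character g
      = (fixedSets b g : ℂ) := by
  classical
  rw [character_ofMulAction, card_fixed_tabloid hn]

theorem character_specht {b' : ℕ} (hn : a + b = n) (hb : b = b' + 1) (g : Equiv.Perm (Fin n)) :
    (specht (twoRow a b hab) n).toRepresentation.character g
      = (fixedSets b g : ℂ) - (fixedSets b' g : ℂ) := by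
  have hab' : b' ≤ a + 1 := by omega
  have hn' : a + 1 + b' = n := by omega
  rw [← character_tabloid (hab := hab) hn, ← character_tabloid (hab := hab') hn']
  exact trace_restrict_ker (lower_surjective hn hn' hb) (lower_ofMulAction g)
    (specht_eq_ker_lower hn hn' hb) ((specht _ n).apply_mem_toSubmodule g)

theorem fixedSets_one (t : ℕ) : fixedSets t (1 : Equiv.Perm (Fin n)) = n.choose t := by
  have : (Finset.univ.filter fun A : Finset (Fin n) =>
      A.card = t ∧ (1 : Equiv.Perm (Fin n)) • A = A) = Finset.univ.powersetCard t := by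
    ext A
    simp [Finset.mem_powersetCard]
  rw [fixedSets, this, Finset.card_powersetCard, Finset.card_univ, Fintype.card_fin]

theorem finrank_specht {b' : ℕ} (hn : a + b = n) (hb : b = b' + 1) :
    (Module.finrank ℂ (specht (twoRow a b hab) n).toSubmodule : ℂ)
      = (n.choose b : ℂ) - (n.choose b' : ℂ) := by
  rw [← Representation.char_one (specht (twoRow a b hab) n).toRepresentation,
    character_specht hn hb, fixedSets_one, fixedSets_one]

/-- A substitute for Schur's lemma. Vectors that transform by the sign under the column stabilizer
of `T` are determined by their value at `T.bot`, so `f` multiplies the polytabloid of `T` by a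
scalar; all polytabloids form one orbit, so the scalar is common. -/
theorem exists_scalar_on_specht (hn : a + b = n)
    {f : MonoidAlgebra ℂ (Tabloid (twoRow a b hab) n) →ₗ[ℂ]
      MonoidAlgebra ℂ (Tabloid (twoRow a b hab) n)}
    (hf : ∀ σ h, f (Representation.ofMulAction ℂ (Equiv.Perm (Fin n)) _ σ h)
      = Representation.ofMulAction ℂ (Equiv.Perm (Fin n)) _ σ (f h)) :
    ∃ c : ℂ, ∀ v ∈ (specht (twoRow a b hab) n).toSubmodule, f v = c • v := by
  obtain ⟨T⟩ := nonempty_tableau (hab := hab) hn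
  have hzero : ∀ v : MonoidAlgebra ℂ (Tabloid (twoRow a b hab) n),
      (∀ τ, IsColPerm T τ → Representation.ofMulAction ℂ (Equiv.Perm (Fin n)) _ τ v
        = ((Equiv.Perm.sign τ : ℤ) : ℂ) • v) → evalBot v T.bot = 0 → v = 0 := by
    intro v hv h0
    apply evalBot_injective
    rw [map_zero]
    exact (IsColAntisymm.evalBot_of_forall hv).eq_zero (evalBot_of_card_ne v) h0
  have hT : ∃ c : ℂ, f (polytabloid T) = c • polytabloid T := by
    by_cases h0 : evalBot (polytabloid T) T.bot = 0
    · refine ⟨0, ?_⟩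
      rw [hzero _ (fun τ hτ => ofMulAction_polytabloid_of_isColPerm hτ) h0]
      simp
    · refine ⟨evalBot (f (polytabloid T)) T.bot / evalBot (polytabloid T) T.bot, ?_⟩
      rw [← sub_eq_zero]
      refine hzero _ (fun τ hτ => ?_) ?_
      · rw [map_sub, map_smul, ← hf, ofMulAction_polytabloid_of_isColPerm hτ, map_smul, smul_sub,
          smul_comm]
      · rw [map_sub, map_smul, Pi.sub_apply, Pi.smul_apply, smul_eq_mul, div_mul_cancel₀ _ h0,
          sub_self]
  obtain ⟨c, hc⟩ := hT
  refine ⟨c, fun v hv => ?_⟩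
  induction hv using Submodule.span_induction with
  | mem x hx =>
    obtain ⟨T', rfl⟩ := hx
    obtain ⟨σ, rfl⟩ := T.exists_smul_eq T'
    rw [← ofMulAction_polytabloid, hf, hc, map_smul]
  | zero => simp
  | add x y _ _ hx hy => rw [map_add, hx, hy, smul_add]
  | smul d x _ hx => rw [map_smul, hx, smul_comm]

end Trace

/-! ### Convolution powers in the group algebra -/

section GroupAlgebra

variable {G : Type*} [Group G] [Fintype G]

theorem toGroupAlgebra_conv (P Q : G → ℝ) :
    toGroupAlgebra (conv P Q) = toGroupAlgebra P * toGroupAlgebra Q := by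
  simp only [toGroupAlgebra, conv, Finset.sum_mul, Finset.mul_sum, MonoidAlgebra.single_mul_single,
    Complex.ofReal_sum, Complex.ofReal_mul]
  have : ∀ h : G, MonoidAlgebra.single h (∑ g, (P (h * g⁻¹) : ℂ) * (Q g : ℂ))
      = ∑ g, MonoidAlgebra.single h ((P (h * g⁻¹) : ℂ) * (Q g : ℂ)) := by
    intro h
    ext x
    classical
    by_cases hx : h = x <;> simp [hx]
  simp only [this]
  rw [Finset.sum_comm]
  refine Finset.sum_congr rfl fun g _ => ?_
  refine Fintype.sum_equiv (Equiv.mulRight g⁻¹) _ _ fun h => ?_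
  simp

theorem toGroupAlgebra_convPow [DecidableEq G] (Q : G → ℝ) (N : ℕ) :
    toGroupAlgebra (convPow Q N) = toGroupAlgebra Q ^ N := by
  induction N with
  | zero =>
    rw [pow_zero, toGroupAlgebra, MonoidAlgebra.one_def, Finset.sum_eq_single 1]
    · simp [convPow]
    · intro g _ hg
      simp [convPow, hg]
    · simp
  | succ N ih => rw [convPow, toGroupAlgebra_conv, ih, pow_succ']

theorem asAlgebraHom_toGroupAlgebra {V : Type*} [AddCommGroup V] [Module ℂ V]
    (ρ : Representation ℂ G V) (Q : G → ℝ) :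
    ρ.asAlgebraHom (toGroupAlgebra Q) = ∑ g, (Q g : ℂ) • ρ g := by
  rw [toGroupAlgebra, map_sum]
  simp [Representation.asAlgebraHom_single]

theorem asAlgebraHom_comm {V : Type*} [AddCommGroup V] [Module ℂ V]
    (ρ : Representation ℂ G V) {Q : G → ℝ} (hQ : ∀ g σ, Q (σ * g * σ⁻¹) = Q g) (σ : G) (v : V) :
    ρ.asAlgebraHom (toGroupAlgebra Q) (ρ σ v) = ρ σ (ρ.asAlgebraHom (toGroupAlgebra Q) v) := by
  simp only [asAlgebraHom_toGroupAlgebra, LinearMap.sum_apply, map_sum, LinearMap.smul_apply,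
    map_smul]
  symm
  refine Fintype.sum_equiv (MulAut.conj σ).toEquiv _ _ fun g => ?_
  have h1 : (MulAut.conj σ).toEquiv g = σ * g * σ⁻¹ := rfl
  rw [h1, hQ, ← Module.End.mul_apply, ← map_mul, ← Module.End.mul_apply, ← map_mul,
    inv_mul_cancel_right]

/-- The trace of the action of `Q^N`. The scalar does not depend on `N`, so it can be read off from
`N = 1`. -/
theorem sum_convPow_mul_character_specht {n a b : ℕ} {hab : b ≤ a} (hn : a + b = n)
    {Q : Equiv.Perm (Fin n) → ℝ} (hQ : ∀ g σ, Q (σ * g * σ⁻¹) = Q g) :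
    ∃ c : ℂ, ∀ N, ∑ g, (convPow Q N g : ℂ) *
        (specht (twoRow a b hab) n).toRepresentation.character g
      = c ^ N * Module.finrank ℂ (specht (twoRow a b hab) n).toSubmodule := by
  set ρ := (specht (twoRow a b hab) n).toRepresentation with hρ
  obtain ⟨c, hc⟩ := exists_scalar_on_specht (hab := hab) hn
    (asAlgebraHom_comm (Representation.ofMulAction ℂ (Equiv.Perm (Fin n))
      (Tabloid (twoRow a b hab) n)) hQ)
  refine ⟨c, fun N => ?_⟩
  have h1 : ρ.asAlgebraHom (toGroupAlgebra Q) = c • LinearMap.id := by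
    ext v : 2
    have := hc v v.2
    simp only [asAlgebraHom_toGroupAlgebra, LinearMap.sum_apply] at this ⊢
    have hcoe : ∀ g, ((ρ g v : (specht (twoRow a b hab) n).toSubmodule) :
        MonoidAlgebra ℂ (Tabloid (twoRow a b hab) n))
        = Representation.ofMulAction ℂ (Equiv.Perm (Fin n)) _ g v := fun _ => rfl
    simpa [hcoe] using this
  have h2 : ρ.asAlgebraHom (toGroupAlgebra (convPow Q N)) = c ^ N • LinearMap.id := by
    rw [toGroupAlgebra_convPow, map_pow, h1, smul_pow]
    congr 1
    exact one_pow N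
  have h3 := congrArg (LinearMap.trace ℂ _) h2
  rw [asAlgebraHom_toGroupAlgebra, map_sum, map_smul, LinearMap.trace_id] at h3
  simpa [Representation.character] using h3

end GroupAlgebra

/-! ### Cycles -/

section Cycles

variable {n k : ℕ}

theorem isKCycle_congr {g h : Equiv.Perm (Fin n)} (hgh : g.cycleType = h.cycleType) :
    IsKCycle n k g ↔ IsKCycle n k h := by
  rw [IsKCycle, IsKCycle, Equiv.Perm.partition_eq_of_isConj.mp
    (Equiv.Perm.isConj_iff_cycleType_eq.mpr hgh)]

theorem IsKCycle.cycleType {g : Equiv.Perm (Fin n)} (hg : IsKCycle n k g) :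
    g.cycleType = if 2 ≤ k then {k} else 0 := by
  rw [← Equiv.Perm.filter_parts_partition_eq_cycleType, hg, Multiset.filter_cons]
  refine add_eq_left.mpr (Multiset.filter_eq_nil.mpr fun a ha => ?_)
  rw [Multiset.eq_of_mem_replicate ha]
  omega

theorem exists_isKCycle (hk : 1 ≤ k) (hkn : k ≤ n) : ∃ g, IsKCycle n k g := by
  rcases hk.eq_or_lt with rfl | hk
  · refine ⟨1, ?_⟩
    rw [IsKCycle, Equiv.Perm.parts_partition]
    simp only [Equiv.Perm.cycleType_one, Equiv.Perm.support_one, Finset.card_empty, zero_add,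
      Fintype.card_fin, Nat.sub_zero]
    rw [← Multiset.replicate_succ]
    congr 1
    omega
  · obtain ⟨g, hg⟩ := (Equiv.Perm.exists_with_cycleType_iff (Fin n) (m := {k})).mpr
      ⟨by simpa using hkn, by simpa using Nat.succ_le_of_lt hk⟩
    refine ⟨g, ?_⟩
    rw [IsKCycle, Equiv.Perm.parts_partition, ← Equiv.Perm.sum_cycleType, hg]
    simp

theorem kCycleDist_congr {g h : Equiv.Perm (Fin n)} (hgh : g.cycleType = h.cycleType) :
    kCycleDist n k g = kCycleDist n k h := by
  unfold kCycleDist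
  classical exact if_congr (isKCycle_congr hgh) rfl rfl

theorem kCycleDist_conj (g σ : Equiv.Perm (Fin n)) :
    kCycleDist n k (σ * g * σ⁻¹) = kCycleDist n k g :=
  kCycleDist_congr (Equiv.Perm.cycleType_conj)

theorem kCycleDist_inv (g : Equiv.Perm (Fin n)) : kCycleDist n k g⁻¹ = kCycleDist n k g :=
  kCycleDist_congr (Equiv.Perm.cycleType_inv g)

theorem sum_kCycleDist (hk : 1 ≤ k) (hkn : k ≤ n) : ∑ g, kCycleDist n k g = 1 := by
  classical
  simp only [kCycleDist]
  rw [← Finset.sum_filter, Finset.sum_const, nsmul_eq_mul, Nat.card_eq_fintype_card,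
    Fintype.card_subtype]
  refine mul_one_div_cancel (Nat.cast_ne_zero.mpr ?_)
  obtain ⟨g, hg⟩ := exists_isKCycle hk hkn
  exact Finset.card_ne_zero_of_mem (a := g) (by simpa using hg)

theorem sum_kCycleDist_mul (hk : 1 ≤ k) (hkn : k ≤ n) {χ : Equiv.Perm (Fin n) → ℂ} {z : ℂ}
    (hχ : ∀ g, IsKCycle n k g → χ g = z) : ∑ g, (kCycleDist n k g : ℂ) * χ g = z := by
  have h1 : ∀ g, (kCycleDist n k g : ℂ) * χ g = (kCycleDist n k g : ℂ) * z := by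
    intro g
    by_cases hg : IsKCycle n k g
    · rw [hχ g hg]
    · simp [kCycleDist, hg]
  simp only [h1]
  rw [← Finset.sum_mul, ← Complex.ofReal_sum, sum_kCycleDist hk hkn]
  simp

theorem smul_eq_self_iff {g : Equiv.Perm (Fin n)} {A : Finset (Fin n)} :
    g • A = A ↔ ∀ x, g x ∈ A ↔ x ∈ A := by
  constructor
  · intro h x
    conv_lhs => rw [← h]
    exact Finset.smul_mem_smul_finset_iff (a := g)
  · intro h
    ext x
    rw [← Finset.inv_smul_mem_iff, ← h]
    simp [Equiv.Perm.smul_def]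

/-- A cycle is transitive on its support, so an invariant set contains the support or misses it. -/
theorem IsKCycle.exists_block (hk : 1 ≤ k) (hkn : k ≤ n) {g : Equiv.Perm (Fin n)}
    (hg : IsKCycle n k g) :
    ∃ c : Finset (Fin n), c.card = k ∧ ∀ A : Finset (Fin n), g • A = A ↔ c ⊆ A ∨ Disjoint c A := by
  have hct := hg.cycleType
  rcases hk.eq_or_lt with rfl | hk
  · rw [if_neg (by omega), Equiv.Perm.cycleType_eq_zero] at hct
    -- The identity has empty support, but any singleton is a block: the dichotomy is then excluded
    -- middle.
    refine ⟨{⟨0, hkn⟩}, Finset.card_singleton _, fun A => ?_⟩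
    rw [hct, one_smul, Finset.singleton_subset_iff, Finset.disjoint_singleton_left]
    simp [em]
  · rw [if_pos (Nat.succ_le_of_lt hk)] at hct
    have hcyc : g.IsCycle := by
      rw [← Equiv.Perm.card_cycleType_eq_one, hct, Multiset.card_singleton]
    refine ⟨g.support, ?_, fun A => ?_⟩
    · rw [← Equiv.Perm.sum_cycleType, hct, Multiset.sum_singleton]
    · rw [smul_eq_self_iff]
      constructor
      · intro h
        have hpow : ∀ (i : ℕ) x, (g ^ i) x ∈ A ↔ x ∈ A := by
          intro i
          induction i with
          | zero => simp
          | succ i ih => intro x; rw [pow_succ', Equiv.Perm.mul_apply, h, ih]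
        by_cases hd : Disjoint g.support A
        · exact Or.inr hd
        · left
          rw [Finset.not_disjoint_iff] at hd
          obtain ⟨x, hx, hxA⟩ := hd
          intro y hy
          obtain ⟨i, rfl⟩ := hcyc.exists_pow_eq (Equiv.Perm.mem_support.mp hx)
            (Equiv.Perm.mem_support.mp hy)
          rwa [hpow]
      · intro h x
        by_cases hx : x ∈ g.support
        · have hgx := Equiv.Perm.apply_mem_support.mpr hx
          rcases h with h | h
          · exact iff_of_true (h hgx) (h hx)
          · exact iff_of_false (Finset.disjoint_left.mp h hgx) (Finset.disjoint_left.mp h hx)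
        · rw [Equiv.Perm.notMem_support.mp hx]

/-- Invariant sets containing the block are counted through their complements; `n - t` avoids the
truncated `t - k` and gives `0` when `t < k`. -/
theorem IsKCycle.fixedSets (hk : 1 ≤ k) (hkn : k ≤ n) {g : Equiv.Perm (Fin n)}
    (hg : IsKCycle n k g) {t : ℕ} (ht : t ≤ n) :
    fixedSets t g = (n - k).choose (n - t) + (n - k).choose t := by
  obtain ⟨c, hc, hA⟩ := hg.exists_block hk hkn
  have h1 : (Finset.univ.filter fun A : Finset (Fin n) => A.card = t ∧ g • A = A)
      = (cᶜ.powersetCard (n - t)).image compl ∪ cᶜ.powersetCard t := by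
    ext A
    rw [Finset.mem_union, Finset.mem_image, Finset.mem_filter, hA, Finset.mem_powersetCard,
      le_compl_iff_disjoint_left]
    constructor
    · rintro ⟨-, rfl, h | h⟩
      · refine Or.inl ⟨Aᶜ, ?_, compl_compl A⟩
        rw [Finset.mem_powersetCard, Finset.card_compl, Fintype.card_fin]
        exact ⟨Finset.compl_subset_compl.mpr h, rfl⟩
      · exact Or.inr ⟨h, rfl⟩
    · rintro (⟨B, hB, rfl⟩ | ⟨h, rfl⟩)
      · rw [Finset.mem_powersetCard] at hB
        refine ⟨Finset.mem_univ _, ?_, Or.inl ?_⟩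
        · rw [Finset.card_compl, Fintype.card_fin, hB.2]
          omega
        · exact le_compl_comm.mp hB.1
      · exact ⟨Finset.mem_univ _, rfl, Or.inr h⟩
  rw [TabloidWalk.fixedSets, h1, Finset.card_union_of_disjoint, Finset.card_image_of_injective _
    compl_injective, Finset.card_powersetCard, Finset.card_powersetCard, Finset.card_compl, hc,
    Fintype.card_fin]
  obtain ⟨x, hx⟩ : c.Nonempty := by rw [← Finset.card_pos]; omega
  rw [Finset.disjoint_left]
  intro A h2 h3
  obtain ⟨B, hB, rfl⟩ := Finset.mem_image.mp h2
  have h4 := (Finset.mem_powersetCard.mp hB).1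
  have h5 := (Finset.mem_powersetCard.mp h3).1
  by_cases hxB : x ∈ B
  · exact Finset.mem_compl.mp (h4 hxB) hx
  · exact Finset.mem_compl.mp (h5 (Finset.mem_compl.mpr hxB)) hx

end Cycles

/-! ### The transition matrix -/

section Transition

variable {G X : Type*} [Group G] [Fintype G] [MulAction G X] [DecidableEq X]

/-- The matrix of transition probabilities of the walk on `X` driven by `P`: the entry at `(y, x)`
is the probability to go from `x` to `y`. -/
def transition (X : Type*) [MulAction G X] [DecidableEq X] (P : G → ℝ) : Matrix X X ℝ :=
  Matrix.of fun y x => ∑ g : G, if g • x = y then P g else 0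

theorem transition_apply (P : G → ℝ) (y x : X) :
    transition X P y x = ∑ g : G, if g • x = y then P g else 0 := rfl

theorem transition_conv [Fintype X] (P Q : G → ℝ) :
    transition X (conv P Q) = transition X P * transition X Q := by
  ext y x
  rw [Matrix.mul_apply]
  simp only [transition_apply, Finset.sum_mul_sum, conv]
  have h1 : ∀ h : G, (if h • x = y then ∑ g, P (h * g⁻¹) * Q g else 0)
      = ∑ g, if h • x = y then P (h * g⁻¹) * Q g else 0 := by
    intro h
    split_ifs <;> simp
  simp only [h1]
  rw [Finset.sum_comm]
  conv_rhs =>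
    enter [2, z]
    rw [Finset.sum_comm]
  conv_rhs => rw [Finset.sum_comm]
  conv_rhs =>
    enter [2, g]
    rw [Finset.sum_comm]
  refine Finset.sum_congr rfl fun g _ => ?_
  refine Fintype.sum_equiv (Equiv.mulRight g⁻¹) _ _ fun h => ?_
  rw [Finset.sum_eq_single (g • x)]
  · simp [mul_smul]
  · intro z _ hz
    simp [hz.symm]
  · simp

theorem transition_convPow [Fintype X] [DecidableEq G] (Q : G → ℝ) (N : ℕ) :
    transition X (convPow Q N) = transition X Q ^ N := by
  induction N with
  | zero =>
    ext y x
    rw [pow_zero, transition_apply, Finset.sum_eq_single 1]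
    · simp [convPow, Matrix.one_apply, eq_comm]
    · intro g _ hg
      simp [convPow, hg]
    · simp
  | succ N ih => rw [convPow, transition_conv, ih, pow_succ']

theorem transition_isSymm {Q : G → ℝ} (hQ : ∀ g, Q g⁻¹ = Q g) : (transition X Q).IsSymm := by
  ext y x
  rw [Matrix.transpose_apply, transition_apply, transition_apply]
  refine Fintype.sum_equiv (Equiv.inv G) _ _ fun g => ?_
  have : g • y = x ↔ g⁻¹ • x = y := by rw [inv_smul_eq_iff, eq_comm]
  simp only [Equiv.inv_apply, hQ, this]

theorem transition_smul_smul {Q : G → ℝ} (hQ : ∀ g σ, Q (σ * g * σ⁻¹) = Q g) (σ : G) (x y : X) :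
    transition X Q (σ • y) (σ • x) = transition X Q y x := by
  rw [transition_apply, transition_apply]
  symm
  refine Fintype.sum_equiv (MulAut.conj σ).toEquiv _ _ fun g => ?_
  have h1 : (MulAut.conj σ).toEquiv g = σ * g * σ⁻¹ := rfl
  rw [h1, hQ]
  simp [mul_smul]

theorem transition_pow_smul_smul [Fintype X] {Q : G → ℝ} (hQ : ∀ g σ, Q (σ * g * σ⁻¹) = Q g)
    (N : ℕ) (σ : G) (x y : X) :
    (transition X Q ^ N) (σ • y) (σ • x) = (transition X Q ^ N) y x := by
  induction N generalizing x y with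
  | zero => simp [Matrix.one_apply]
  | succ N ih =>
    rw [pow_succ, Matrix.mul_apply, Matrix.mul_apply]
    symm
    refine Fintype.sum_equiv (MulAction.toPerm σ) _ _ fun z => ?_
    rw [MulAction.toPerm_apply, ih, transition_smul_smul hQ]

theorem trace_transition [Fintype X] (P : G → ℝ) :
    (transition X P).trace = ∑ g, P g * (Finset.univ.filter fun x : X => g • x = x).card := by
  simp only [Matrix.trace, Matrix.diag_apply, transition_apply]
  rw [Finset.sum_comm]
  refine Finset.sum_congr rfl fun g _ => ?_
  rw [← Finset.sum_filter, Finset.sum_const, nsmul_eq_mul, mul_comm]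

theorem sum_transition [Fintype X] (P : G → ℝ) (x : X) :
    ∑ y, transition X P y x = ∑ g, P g := by
  simp only [transition_apply]
  rw [Finset.sum_comm]
  simp

theorem sum_convPow [DecidableEq G] {Q : G → ℝ} (hQ : ∑ g, Q g = 1) (N : ℕ) :
    ∑ g, convPow Q N g = 1 := by
  induction N with
  | zero => simp [convPow]
  | succ N ih =>
    simp only [convPow, conv]
    rw [Finset.sum_comm]
    have : ∀ g : G, ∑ h, Q (h * g⁻¹) * convPow Q N g = convPow Q N g := by
      intro g
      have h1 : ∑ h, Q (h * g⁻¹) = 1 := (Equiv.sum_comp (Equiv.mulRight g⁻¹) Q).trans hQ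
      rw [← Finset.sum_mul, h1, one_mul]
    simp only [this, ih]

theorem coeff_act_single (P : G → ℝ) (x y : X) :
    (act (toGroupAlgebra P) (MonoidAlgebra.single x (1 : ℂ))).coeff y
      = (transition X P y x : ℂ) := by
  rw [act, asAlgebraHom_toGroupAlgebra, transition_apply, LinearMap.sum_apply,
    MonoidAlgebra.coeff_sum, Finsupp.finsetSum_apply, Complex.ofReal_sum]
  refine Finset.sum_congr rfl fun g _ => ?_
  rw [LinearMap.smul_apply, Representation.ofMulAction_single, MonoidAlgebra.coeff_smul,
    Finsupp.smul_apply, MonoidAlgebra.coeff_single, Finsupp.single_apply]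
  split_ifs <;> simp

/-- The upper bound lemma for a random walk on a homogeneous space that is driven by a symmetric
class function: the total variation distance is bounded by a sum over fixed points. -/
theorem tvNorm_sq_le_trace [Fintype X] [DecidableEq G]
    (htrans : ∀ x y : X, ∃ g : G, g • x = y) {Q : G → ℝ} (hconj : ∀ g σ, Q (σ * g * σ⁻¹) = Q g)
    (hinv : ∀ g, Q g⁻¹ = Q g) (hsum : ∑ g, Q g = 1) (N : ℕ) (x₀ : X) :
    tvNorm (act (toGroupAlgebra (convPow Q N)) (MonoidAlgebra.single x₀ (1 : ℂ)) - uniformVec X) ^ 2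
      ≤ 1 / 4 * (∑ g, convPow Q (2 * N) g * (Finset.univ.filter fun x : X => g • x = x).card
          - 1) := by
  set T := transition X Q with hT
  have hX : (Fintype.card X : ℝ) ≠ 0 := by
    have : Nonempty X := ⟨x₀⟩
    exact Nat.cast_ne_zero.mpr Fintype.card_ne_zero
  have hcoeff : ∀ y, ‖(act (toGroupAlgebra (convPow Q N)) (MonoidAlgebra.single x₀ (1 : ℂ))
      - uniformVec X).coeff y‖ = |(T ^ N) y x₀ - 1 / Fintype.card X| := by
    intro y
    rw [MonoidAlgebra.coeff_sub, Finsupp.sub_apply, coeff_act_single, uniformVec,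
      coeff_sum_single, transition_convPow, ← Real.norm_eq_abs, ← Complex.norm_real]
    push_cast
    rfl
  have hone : ∑ y, (T ^ N) y x₀ = 1 := by
    rw [hT, ← transition_convPow, sum_transition, sum_convPow hsum]
  have hsymm : ∀ x y, (T ^ N) x y = (T ^ N) y x := by
    intro x y
    exact ((transition_isSymm hinv).pow N).apply y x
  -- Symmetry of `T` turns the `ℓ²` norm of a column into a return probability.
  have hsq : ∑ y, (T ^ N) y x₀ ^ 2 = (T ^ (2 * N)) x₀ x₀ := by
    rw [two_mul, pow_add, Matrix.mul_apply]
    refine Finset.sum_congr rfl fun y _ => ?_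
    rw [hsymm x₀ y, sq]
  -- Conjugation invariance and transitivity make the diagonal constant.
  have htr : (T ^ (2 * N)).trace = Fintype.card X * (T ^ (2 * N)) x₀ x₀ := by
    rw [Matrix.trace, Finset.sum_congr rfl (g := fun _ => (T ^ (2 * N)) x₀ x₀)]
    · simp
    · intro x _
      obtain ⟨σ, rfl⟩ := htrans x₀ x
      exact transition_pow_smul_smul hconj _ σ x₀ x₀
  rw [← trace_transition, transition_convPow, ← hT, htr, ← hsq]
  have hcs := sq_sum_le_card_mul_sum_sq (s := (Finset.univ : Finset X))
    (f := fun y => |(T ^ N) y x₀ - 1 / Fintype.card X|)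
  simp only [sq_abs] at hcs
  have hexp : Fintype.card X * ∑ y, ((T ^ N) y x₀ - 1 / Fintype.card X) ^ 2
      = Fintype.card X * ∑ y, (T ^ N) y x₀ ^ 2 - 1 := by
    have h1 : ∀ y, ((T ^ N) y x₀ - 1 / Fintype.card X) ^ 2
        = (T ^ N) y x₀ ^ 2 - 2 / Fintype.card X * (T ^ N) y x₀ + (1 / Fintype.card X) ^ 2 := by
      intro y; ring
    simp only [h1, Finset.sum_add_distrib, Finset.sum_sub_distrib, ← Finset.mul_sum, hone]
    rw [Finset.sum_const, Finset.card_univ, nsmul_eq_mul]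
    field_simp
    ring
  rw [Finset.card_univ, hexp] at hcs
  simp only [tvNorm, hcoeff]
  rw [mul_pow]
  linarith

end Transition

/-! ### Specht characters on `k`-cycles and the resulting terms of the bound. -/

theorem fixedSets_zero {n : ℕ} (g : Equiv.Perm (Fin n)) : fixedSets 0 g = 1 := by
  rw [fixedSets, Finset.card_eq_one]
  refine ⟨∅, ?_⟩
  ext A
  simp only [Finset.mem_filter, Finset.mem_univ, true_and, Finset.card_eq_zero,
    Finset.mem_singleton, and_iff_left_iff_imp]
  rintro rfl
  simp

section Cycles

variable {n k t : ℕ}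

theorem character_specht_of_isKCycle (hk : 1 ≤ k) (hkn : k ≤ n) (ht : 1 ≤ t) (htn : t ≤ n - t)
    {g : Equiv.Perm (Fin n)} (hg : IsKCycle n k g) :
    (specht (twoRow (n - t) t htn) n).toRepresentation.character g
      = (((n - k).choose (n - t) : ℂ) - ((n - k).choose (n + 1 - t) : ℂ))
        + (((n - k).choose t : ℂ) - ((n - k).choose (t - 1) : ℂ)) := by
  rw [character_specht (b' := t - 1) (by omega) (by omega), hg.fixedSets hk hkn (by omega),
    hg.fixedSets hk hkn (by omega), show n - (t - 1) = n + 1 - t by omega]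
  push_cast
  ring

/-- The scalar is `χ / d`, so the trace is `(χ / d)^{2N} d`. The integer exponent lets `N = 0` give
`d`, where truncated subtraction would give `1`. -/
theorem sum_convPow_kCycleDist_mul_fixedSets (hk : 1 ≤ k) (hkn : k ≤ n) (ht : 1 ≤ t)
    (htn : t ≤ n - t) (N : ℕ) :
    ∑ g, convPow (kCycleDist n k) (2 * N) g * ((fixedSets t g : ℝ) - fixedSets (t - 1) g)
      = ((((n - k).choose (n - t) : ℝ) - ((n - k).choose (n + 1 - t) : ℝ))
          + (((n - k).choose t : ℝ) - ((n - k).choose (t - 1) : ℝ))) ^ (2 * N)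
        / ((n.choose t : ℝ) - (n.choose (t - 1) : ℝ)) ^ (2 * (N : ℤ) - 1) := by
  obtain ⟨c, hc⟩ := sum_convPow_mul_character_specht (hab := htn) (by omega)
    (kCycleDist_conj (n := n) (k := k))
  have hd : (Module.finrank ℂ (specht (twoRow (n - t) t htn) n).toSubmodule : ℂ)
      = (n.choose t : ℂ) - (n.choose (t - 1) : ℂ) := finrank_specht (by omega) (by omega)
  have hd0 : (n.choose t : ℝ) - (n.choose (t - 1) : ℝ) ≠ 0 := by
    rw [sub_ne_zero]
    -- By the ratio of consecutive binomials, equality would force `2 * t = n + 1`, contrary to `t ≤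
    -- n - t`.
    have h1 := Nat.choose_succ_right_eq n (t - 1)
    rw [show t - 1 + 1 = t by omega] at h1
    have h2 : 0 < n.choose (t - 1) := Nat.choose_pos (by omega)
    intro h
    have h3 : n.choose t = n.choose (t - 1) := by exact_mod_cast h
    rw [h3] at h1
    have := Nat.eq_of_mul_eq_mul_left h2 h1
    omega
  set χ : ℝ := (((n - k).choose (n - t) : ℝ) - ((n - k).choose (n + 1 - t) : ℝ))
    + (((n - k).choose t : ℝ) - ((n - k).choose (t - 1) : ℝ)) with hχ
  set d : ℝ := (n.choose t : ℝ) - (n.choose (t - 1) : ℝ) with hdd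
  have hdc : (Module.finrank ℂ (specht (twoRow (n - t) t htn) n).toSubmodule : ℂ) = (d : ℂ) := by
    rw [hd, hdd]; push_cast; rfl
  -- At `N = 1` the sum is the average of a character that is constant on `k`-cycles.
  have hcd : c * d = χ := by
    have h1 := hc 1
    have h2 : convPow (kCycleDist n k) 1 = kCycleDist n k := by
      ext g
      simp [convPow, conv]
    rw [h2, pow_one, hdc] at h1
    rw [← h1]
    refine sum_kCycleDist_mul hk hkn fun g hg => ?_
    rw [character_specht_of_isKCycle hk hkn ht htn hg, hχ]
    push_cast
    rfl
  have hd0' : (d : ℂ) ≠ 0 := Complex.ofReal_ne_zero.mpr hd0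
  have hc' : c = χ / d := (eq_div_iff hd0').mpr hcd
  have h2N := hc (2 * N)
  rw [hdc, hc'] at h2N
  have hchar : ∀ g, (specht (twoRow (n - t) t htn) n).toRepresentation.character g
      = (fixedSets t g : ℂ) - (fixedSets (t - 1) g : ℂ) :=
    character_specht (by omega) (by omega)
  simp only [hchar] at h2N
  have hreal : ∑ g, convPow (kCycleDist n k) (2 * N) g *
      ((fixedSets t g : ℝ) - fixedSets (t - 1) g) = (χ / d) ^ (2 * N) * d := by
    exact_mod_cast h2N
  rw [hreal, zpow_sub_one₀ hd0, div_pow]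
  have : d ^ (2 * (N : ℤ)) = d ^ (2 * N) := by exact_mod_cast zpow_natCast d (2 * N)
  rw [this]
  field_simp

end Cycles

end TabloidWalk

theorem mainTheorem9 (n a b k N : ℕ) (hab : b ≤ a) (hn : a + b = n) (hk : 1 ≤ k) (hkn : k ≤ n)
    (x₀ : TabloidWalk.Tabloid (TabloidWalk.twoRow a b hab) n) :
    TabloidWalk.tvNorm
        (TabloidWalk.act
            (TabloidWalk.toGroupAlgebra
              (TabloidWalk.convPow (TabloidWalk.kCycleDist n k) N))
            (MonoidAlgebra.single x₀ (1 : ℂ))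
          - TabloidWalk.uniformVec (TabloidWalk.Tabloid (TabloidWalk.twoRow a b hab) n)) ^ 2
      ≤ (1 / 4 : ℝ) * ∑ t ∈ Finset.Icc 1 b,
          ((((n - k).choose (n - t) : ℝ) - ((n - k).choose (n + 1 - t) : ℝ))
              + (((n - k).choose t : ℝ) - ((n - k).choose (t - 1) : ℝ))) ^ (2 * N)
            / ((n.choose t : ℝ) - (n.choose (t - 1) : ℝ)) ^ (2 * (N : ℤ) - 1)
    ∧ ∀ t ∈ Finset.Icc 1 b, ∃ ht : t ≤ n - t,
        (∀ g : Equiv.Perm (Fin n), TabloidWalk.IsKCycle n k g →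
          (TabloidWalk.specht (TabloidWalk.twoRow (n - t) t ht) n).toRepresentation.character g
            = (((n - k).choose (n - t) : ℂ) - ((n - k).choose (n + 1 - t) : ℂ))
              + (((n - k).choose t : ℂ) - ((n - k).choose (t - 1) : ℂ)))
        ∧ (Module.finrank ℂ
            (TabloidWalk.specht (TabloidWalk.twoRow (n - t) t ht) n).toSubmodule : ℝ)
            = (n.choose t : ℝ) - (n.choose (t - 1) : ℝ) := by
  classical
  have hQ := TabloidWalk.sum_kCycleDist hk hkn
  constructor
  · refine (TabloidWalk.tvNorm_sq_le_trace TabloidWalk.Tabloid.exists_smul_eq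
      TabloidWalk.kCycleDist_conj TabloidWalk.kCycleDist_inv hQ N x₀).trans_eq ?_
    congr 1
    simp only [TabloidWalk.card_fixed_tabloid hn]
    -- Telescoping over `t`. The initial `1` comes from the empty set, that is, the trivial
    -- representation, and cancels the `-1` of the upper bound lemma.
    have htel : ∀ m ≤ b, ∑ g, TabloidWalk.convPow (TabloidWalk.kCycleDist n k) (2 * N) g *
          (TabloidWalk.fixedSets m g : ℝ)
        = 1 + ∑ t ∈ Finset.Icc 1 m,
          ((((n - k).choose (n - t) : ℝ) - ((n - k).choose (n + 1 - t) : ℝ))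
              + (((n - k).choose t : ℝ) - ((n - k).choose (t - 1) : ℝ))) ^ (2 * N)
            / ((n.choose t : ℝ) - (n.choose (t - 1) : ℝ)) ^ (2 * (N : ℤ) - 1) := by
      intro m
      induction m with
      | zero =>
        intro _
        simp [TabloidWalk.fixedSets_zero, TabloidWalk.sum_convPow hQ]
      | succ m ih =>
        intro hm
        rw [Finset.sum_Icc_succ_top (by omega), ← add_assoc, ← ih (by omega),
          ← TabloidWalk.sum_convPow_kCycleDist_mul_fixedSets hk hkn (by omega) (by omega) N,
          ← Finset.sum_add_distrib]
        refine Finset.sum_congr rfl fun g _ => ?_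
        rw [Nat.add_sub_cancel]
        ring
    rw [htel b le_rfl, add_sub_cancel_left]
  · intro t ht
    rw [Finset.mem_Icc] at ht
    refine ⟨by omega, fun g hg =>
      TabloidWalk.character_specht_of_isKCycle hk hkn ht.1 (by omega) hg, ?_⟩
    have h := TabloidWalk.finrank_specht (n := n) (a := n - t) (b := t) (b' := t - 1)
      (hab := by omega) (by omega) (by omega)
    exact_mod_cast h
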